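/- Notation. Let $\tau\in\mathbb{C}$ with $\operatorname{Im}\tau>0$, $q=e^{2\pi i\tau}$, $z=e^{2\pi i u}$, and $q^a=e^{2\pi i\tau a}$, $z^a=e^{2\pi i u a}$ for $a\in\mathbb{Q}$. For integers $m\ge 1$ and $n$ put $$\Theta_{n,m}(z,q)=\sum_{x\in\mathbb{Z}+n/2m}q^{mx^2}z^{-mx}.$$ For coprime integers $1\le p<p'$, $N=p'/p-2$ and $\ell\in\{0,\dots,p'-2\}$ let $$\chi_\ell^N(z,q)=\frac{\sum_{\sigma=\pm1}\sigma\,\Theta_{\sigma(\ell+1),p'}(z,q^p)}{\sum_{\sigma=\pm1}\sigma\,\Theta_{\sigma,2}(z,q)}$$ (the normalized character of the admissible $A_1^{(1)}$-module of highest weight $(N-\ell)\Lambda_0+\ell\Lambda_1$, in the Kac--Wakimoto form). For $N\neq0$ the string functions $C_{m,\ell}^N(q)$, $m\in2\mathbb{Z}+\ell$, are the coefficients in the expansion $$\chi_\ell^N(z,q)=\sum_{m\in2\mathbb{Z}+\ell}C_{m,\ell}^N(q)\,q^{m^2/4N}z^{-m/2}\qquad(|q|<|z|<1).$$ Let $p_1,p_1',p_2,p_2'$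 be integers with $1\le p_i<p_i'$, $\gcd(p_i,p_i')=1$ for $i=1,2$, and $p_1=1$ or $p_2=1$. Put $N_i=p_i'/p_i-2$, $p_3=p_1p_2$, $p_3'=p_1'p_2+p_2'p_1-2p_1p_2$, so that $N_3:=N_1+N_2=p_3'/p_3-2$. The $A_1^{(1)}$ branching functions $B^{N_1,N_2}_{\ell_1,\ell_2,\ell_3}(q)$ are the coefficients in $$\chi_{\ell_1}^{N_1}(z,q)\,\chi_{\ell_2}^{N_2}(z,q)=\sum_{\substack{0\le\ell_3\le p_3'-2\\ \ell_1+\ell_2+\ell_3\ \mathrm{even}}}B^{N_1,N_2}_{\ell_1,\ell_2,\ell_3}(q)\,\chi_{\ell_3}^{N_3}(z,q)\qquad(|q|<|z|<1).$$ Theorem. In this setting suppose $N_2\ne0$ ($N_2$ need not be an integer), and let $P=p_1'$, $P'=p_1'+N_2p_1$. Let $r,\ell,s$ be integers with $1\le r\le P-1$, $1\le\ell+1\le p_2'-1$, $1\le s\le p_2P'-1$ and $r+\ell+s$ even. Then the string functions $C^{N_2}_{m,\ell}(q)$ and the branching functions $B^{N_1,N_2}_{r-1,\ell,\,\cdot\,}(q)$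 and $B^{N_2,N_1}_{\ell,r-1,\,\cdot\,}(q)$ exist and are uniquely determined by the expansions above, the following series converges absolutely, and $$B^{N_1,N_2}_{r-1,\ell,s-1}(q)=B^{N_2,N_1}_{\ell,r-1,s-1}(q)=q^{\frac{(P'r-Ps)^2}{4N_2PP'}}\sum_{j\in\mathbb{Z}}\Bigl\{q^{\frac{j}{N_2}(PP'j+P'r-Ps)}C^{N_2}_{2Pj+r-s,\ell}(q)-q^{\frac1{N_2}(Pj+r)(P'j+s)}C^{N_2}_{2Pj+r+s,\ell}(q)\Bigr\}.$$ -/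

import Mathlib

/- Throughout, `q = exp (2πiτ)` with `0 < im τ` and `z = exp (2πiu)`; fractional powers of `q` and `z`
are `q ^ a = exp (2πiτa)` and `z ^ a = exp (2πiua)` for rational `a`. -/

noncomputable section

/-- `epow x a = exp (2πi x a)`, so that `epow τ a` is `q ^ a` and `epow u a` is `z ^ a`. -/
def epow (x : ℂ) (a : ℚ) : ℂ :=
  Complex.exp (2 * (Real.pi : ℂ) * Complex.I * x * (a : ℂ))

/-- The classical theta function of degree `m` and characteristic `n`,
`Θ_{n,m}(z,q) = ∑_{x ∈ ℤ + n/(2m)} q ^ (m x²) z ^ (-m x)`. -/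
def classicalTheta (n : ℤ) (m : ℕ) (u τ : ℂ) : ℂ :=
  ∑' j : ℤ, epow τ ((m : ℚ) * ((j : ℚ) + (n : ℚ) / (2 * (m : ℚ))) ^ 2) *
    epow u (-((m : ℚ) * ((j : ℚ) + (n : ℚ) / (2 * (m : ℚ)))))

/-- The level `N = p'/p - 2`. -/
def affineLevel (p p' : ℕ) : ℚ := (p' : ℚ) / (p : ℚ) - 2

/-- The normalized character `χ_ℓ^N(z,q)` of the admissible `A₁^{(1)}`-module of highest weight
`(N - ℓ)Λ₀ + ℓΛ₁`, `N = p'/p - 2`, as a quotient of theta functions: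
`∑_σ σ Θ_{σ(ℓ+1),p'}(z,q^p) / ∑_σ σ Θ_{σ,2}(z,q)`, where `σ = ±1`. -/
def affineCharacter (p p' ℓ : ℕ) (u τ : ℂ) : ℂ :=
  (classicalTheta ((ℓ : ℤ) + 1) p' u ((p : ℂ) * τ) -
      classicalTheta (-((ℓ : ℤ) + 1)) p' u ((p : ℂ) * τ)) /
    (classicalTheta 1 2 u τ - classicalTheta (-1) 2 u τ)

/-- `C` is the family of coefficients in the expansion
`χ_ℓ^N(z,q) = ∑_{m ∈ 2ℤ + ℓ} C_m q ^ (m²/(4N)) z ^ (-m/2)` on the annulus `|q| < |z| < 1`.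
Coefficients of the wrong parity do not occur in the expansion and are set to `0`. -/
def IsStringExpansion (p p' ℓ : ℕ) (τ : ℂ) (C : ℤ → ℂ) : Prop :=
  (∀ m : ℤ, ¬ Even (m + (ℓ : ℤ)) → C m = 0) ∧
  ∀ u : ℂ, 0 < u.im → u.im < τ.im →
    HasSum (fun k : ℤ =>
        C (2 * k + (ℓ : ℤ)) *
          epow τ (((2 * k + (ℓ : ℤ) : ℤ) : ℚ) ^ 2 / (4 * affineLevel p p')) *
          epow u (-((2 * k + (ℓ : ℤ) : ℤ) : ℚ) / 2))
      (affineCharacter p p' ℓ u τ)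

/-- The string function `C_{m,ℓ}^N(q)` of level `N = p'/p - 2`, a coefficient of the expansion
`IsStringExpansion`. -/
def stringFunction (p p' : ℕ) (m : ℤ) (ℓ : ℕ) (τ : ℂ) : ℂ :=
  Classical.epsilon (IsStringExpansion p p' ℓ τ) m

/-- `p₃' = p₁'p₂ + p₂'p₁ - 2p₁p₂`, so that `p₃'/(p₁p₂) - 2 = N₁ + N₂`. The subtraction does not
truncate when `p₁ < p₁'` and `p₂ < p₂'`. -/
def sumNumerator (p₁ p₁' p₂ p₂' : ℕ) : ℕ := p₁' * p₂ + p₂' * p₁ - 2 * p₁ * p₂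

/-- `B` is the family of coefficients `ℓ₃ ↦ B_{ℓ₁,ℓ₂,ℓ₃}^{N₁,N₂}(q)` in the decomposition
`χ_{ℓ₁}^{N₁}(z,q) χ_{ℓ₂}^{N₂}(z,q) = ∑_{ℓ₃} B_{ℓ₁,ℓ₂,ℓ₃}^{N₁,N₂}(q) χ_{ℓ₃}^{N₁+N₂}(z,q)`
on the annulus `|q| < |z| < 1`, the sum being over `0 ≤ ℓ₃ ≤ p₃' - 2` with `ℓ₁ + ℓ₂ + ℓ₃` even.
Coefficients outside this range do not occur and are set to `0`. -/
def IsBranchingExpansion (p₁ p₁' p₂ p₂' ℓ₁ ℓ₂ : ℕ) (τ : ℂ) (B : ℕ → ℂ) : Prop :=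
  (∀ ℓ₃ : ℕ, ¬ (ℓ₃ < sumNumerator p₁ p₁' p₂ p₂' - 1 ∧ Even (ℓ₁ + ℓ₂ + ℓ₃)) → B ℓ₃ = 0) ∧
  ∀ u : ℂ, 0 < u.im → u.im < τ.im →
    affineCharacter p₁ p₁' ℓ₁ u τ * affineCharacter p₂ p₂' ℓ₂ u τ =
      ∑ ℓ₃ ∈ (Finset.range (sumNumerator p₁ p₁' p₂ p₂' - 1)).filter
          (fun ℓ₃ => Even (ℓ₁ + ℓ₂ + ℓ₃)),
        B ℓ₃ * affineCharacter (p₁ * p₂) (sumNumerator p₁ p₁' p₂ p₂') ℓ₃ u τ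

/-- The branching function `B_{ℓ₁,ℓ₂,ℓ₃}^{N₁,N₂}(q)`, `Nᵢ = pᵢ'/pᵢ - 2`, a coefficient of the
decomposition `IsBranchingExpansion`. -/
def branchingFunction (p₁ p₁' p₂ p₂' ℓ₁ ℓ₂ ℓ₃ : ℕ) (τ : ℂ) : ℂ :=
  Classical.epsilon (IsBranchingExpansion p₁ p₁' p₂ p₂' ℓ₁ ℓ₂ τ) ℓ₃

/-- The summand
`q ^ (j(PP'j + P'r - Ps)/N) C_{2Pj+r-s,ℓ}^N(q) - q ^ ((Pj+r)(P'j+s)/N) C_{2Pj+r+s,ℓ}^N(q)`,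
where `N = p'/p - 2`. -/
def branchingTerm (p p' P : ℕ) (P' : ℚ) (r s ℓ : ℕ) (τ : ℂ) (j : ℤ) : ℂ :=
  epow τ ((j : ℚ) * ((P : ℚ) * P' * (j : ℚ) + P' * (r : ℚ) - (P : ℚ) * (s : ℚ)) /
      affineLevel p p') *
    stringFunction p p' (2 * (P : ℤ) * j + (r : ℤ) - (s : ℤ)) ℓ τ -
  epow τ (((P : ℚ) * (j : ℚ) + (r : ℚ)) * (P' * (j : ℚ) + (s : ℚ)) / affineLevel p p') *
    stringFunction p p' (2 * (P : ℤ) * j + (r : ℤ) + (s : ℤ)) ℓ τ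

end

/-! Put w = z^(-1/2), so that the annulus |q| < |z| < 1 becomes 1 < |w|^2 < |q|^(-1), the strip 0 <
Im u < Im τ. Clearing one Weyl denominator from each side of the branching expansion turns it into
an expansion of `thetaProduct` (two theta numerators over the denominator) in theta numerators of
degree p₃'. Let f be the Laurent coefficients of `thetaProduct` in w. They are computed in two ways.

First, f is odd, has fixed parity of support, and is quasi-periodic under n ↦ n - 2p₃'. The last
property needs an expansion valid both on the fundamental strip and on its translate by 2p₁p₂τ. This
is where p₁ = 1 or p₂ = 1 enters: a quotient with p = 1 has the same Laurent expansion on every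
strip (`exists_hasSum_thetaRatio_strips`), and the other numerator converges everywhere. Such an f
is a unique combination of theta numerators (`eq_sum_branchingCoeff`), so each branching function is
one coefficient f(s) times a power of q (`isBranchingExpansion_iff`).

Second, `thetaProduct` is a theta numerator times a single character, whose Laurent coefficients c
are string functions up to powers of q. Hence f(s) is a convolution of theta coefficients with c.
Since c is even, the two halves of the numerator combine into differences c(2Pj+r-s) - c(2Pj+r+s)
(`hasSum_laurentMul_thetaCoeff`), and comparing exponents of q gives the formula
(`hasSum_branchingTerm`).

The Jacobi triple product, up to a constant, supplies what is needed about the denominator: it has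
no zeros in the strip, and its reciprocal can be expanded so that c is even. -/

/-! ### Laurent series: products, symmetries, uniqueness -/

theorem hasSum_congr_fun {β : Type*} {f g : β → ℂ} {a : ℂ} (h : ∀ b, f b = g b) :
    HasSum f a ↔ HasSum g a := by
  rw [funext h]

/-- The coefficients of the product of two Laurent series. -/
noncomputable def laurentMul (a b : ℤ → ℂ) (n : ℤ) : ℂ := ∑' k : ℤ, a k * b (n - k)

/-- Convergence in ℂ is absolute, so the double series may be regrouped along the antidiagonals (n,
k) ↦ (k, n - k). -/
theorem HasSum.laurentMul {a b : ℤ → ℂ} {w f g : ℂ} (hw : w ≠ 0)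
    (ha : HasSum (fun n : ℤ => a n * w ^ n) f) (hb : HasSum (fun n : ℤ => b n * w ^ n) g) :
    (∀ n, Summable fun k : ℤ => a k * b (n - k)) ∧
      HasSum (fun n : ℤ => laurentMul a b n * w ^ n) (f * g) := by
  have hs := summable_mul_of_summable_norm ha.summable.norm hb.summable.norm
  have h := ha.mul hb hs
  let e : ℤ × ℤ ≃ ℤ × ℤ :=
    ⟨fun x => (x.2, x.1 - x.2), fun y => (y.1 + y.2, y.1), fun x => by simp, fun y => by simp⟩
  have h' := e.hasSum_iff.mpr h
  have key : ∀ n k : ℤ, ((fun x : ℤ × ℤ => a x.1 * w ^ x.1 * (b x.2 * w ^ x.2)) ∘ e) (n, k) =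
      a k * b (n - k) * w ^ n := by
    intro n k
    simp only [Function.comp, e, Equiv.coe_fn_mk]
    rw [show w ^ n = w ^ k * w ^ (n - k) by rw [← zpow_add₀ hw]; congr 1; ring]
    ring
  have hn : ∀ n, Summable fun k : ℤ => a k * b (n - k) := by
    intro n
    have h2 := h'.summable.prod_factor n
    simp only [key] at h2
    exact (summable_mul_right_iff (zpow_ne_zero n hw)).mp h2
  refine ⟨hn, ?_⟩
  refine h'.prod_fiberwise fun n => ?_
  simp only [key]
  exact (hn n).hasSum.mul_right _

theorem hasSum_laurent_inv {c : ℤ → ℂ} {w f : ℂ} (h : HasSum (fun n : ℤ => c n * w⁻¹ ^ n) f) :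
    HasSum (fun n : ℤ => c (-n) * w ^ n) f := by
  have := (Equiv.neg ℤ).hasSum_iff.mpr h
  refine (hasSum_congr_fun fun n => ?_).mp this
  simp

theorem hasSum_laurent_shift {c : ℤ → ℂ} {w f : ℂ} (hw : w ≠ 0)
    (h : HasSum (fun n : ℤ => c n * w ^ n) f) (k : ℤ) :
    HasSum (fun n : ℤ => c (n - k) * w ^ n) (w ^ k * f) := by
  have := ((Equiv.subRight k).hasSum_iff.mpr h).mul_left (w ^ k)
  refine (hasSum_congr_fun fun n => ?_).mpr this
  simp only [Function.comp, Equiv.subRight_apply]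
  rw [show w ^ n = w ^ k * w ^ (n - k) by rw [← zpow_add₀ hw]; congr 1; ring]
  ring

theorem hasSum_laurent_mul {c : ℤ → ℂ} {w v f : ℂ}
    (h : HasSum (fun n : ℤ => c n * (w * v) ^ n) f) :
    HasSum (fun n : ℤ => (c n * v ^ n) * w ^ n) f := by
  refine (hasSum_congr_fun fun n => ?_).mpr h
  rw [mul_zpow]; ring

theorem hasSum_laurent_of_injective {h : ℕ → ℂ} {w f : ℂ} {i : ℕ → ℤ} (hi : i.Injective)
    (hf : HasSum (fun n : ℕ => h n * w ^ i n) f) :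
    HasSum (fun n : ℤ => Function.extend i h 0 n * w ^ n) f := by
  rw [← hi.hasSum_iff]
  · convert hf using 2 with n
    simp [hi.extend_apply]
  · intro x hx
    rw [Function.extend_apply' _ _ _ (by simpa using hx)]
    simp

theorem laurentMul_even {a b : ℤ → ℂ} (ha : ∀ n, a (-n) = a n) (hb : ∀ n, b (-n) = b n) (n : ℤ) :
    laurentMul a b (-n) = laurentMul a b n := by
  unfold laurentMul
  rw [← (Equiv.neg ℤ).tsum_eq]
  refine tsum_congr fun k => ?_
  rw [Equiv.neg_apply, ha, ← hb (n - k)]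
  congr 2; ring

theorem laurentMul_odd {a b : ℤ → ℂ} (ha : ∀ n, a (-n) = a n) (hb : ∀ n, b (-n) = -b n) (n : ℤ) :
    laurentMul a b (-n) = -laurentMul a b n := by
  unfold laurentMul
  rw [← (Equiv.neg ℤ).tsum_eq, ← tsum_neg]
  refine tsum_congr fun k => ?_
  rw [Equiv.neg_apply, ha, ← mul_neg, ← hb (n - k)]
  congr 2; ring

theorem laurentMul_reflect_even (a : ℤ → ℂ) (n : ℤ) :
    laurentMul a (fun k => a (-k)) (-n) = laurentMul a (fun k => a (-k)) n := by
  unfold laurentMul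
  rw [← (Equiv.subRight n).tsum_eq]
  refine tsum_congr fun k => ?_
  rw [Equiv.subRight_apply, mul_comm]
  congr 2 <;> ring_nf

/-- Absolute convergence on one circle suffices: integrating termwise over it against the k-th
character isolates c k. -/
theorem eq_zero_of_hasSum_laurent_zero {c : ℤ → ℂ} {R : ℝ} (hR : 0 < R)
    (h : ∀ w : ℂ, ‖w‖ = R → HasSum (fun n : ℤ => c n * w ^ n) 0) : c = 0 := by
  funext k
  have hs : Summable fun n : ℤ => ‖c n‖ * R ^ n := by
    have := (h R (by simp [abs_of_pos hR])).summable.norm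
    simpa [abs_of_pos hR] using this
  let F : ℤ → ℝ → ℂ := fun n θ => c n * (R : ℂ) ^ n * Complex.exp (((n - k : ℤ) : ℂ) * θ * Complex.I)
  have hF : HasSum (fun n => ∫ θ in (0 : ℝ)..(2 * Real.pi), F n θ)
      (∫ θ in (0 : ℝ)..(2 * Real.pi), (0 : ℂ)) := by
    refine intervalIntegral.hasSum_integral_of_dominated_convergence
      (fun n _ => ‖c n‖ * R ^ n) (fun n => ?_) (fun n => ?_) ?_ ?_ ?_
    · exact Continuous.aestronglyMeasurable (by fun_prop)
    · refine Filter.Eventually.of_forall fun θ _ => ?_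
      simp only [F, norm_mul, norm_zpow, Complex.norm_real, Real.norm_eq_abs, abs_of_pos hR]
      rw [show (((n - k : ℤ) : ℂ) * θ * Complex.I) = (((n - k : ℤ) * θ : ℝ) : ℂ) * Complex.I by
        push_cast; ring, Complex.norm_exp_ofReal_mul_I, mul_one]
    · exact Filter.Eventually.of_forall fun θ _ => hs
    · exact intervalIntegrable_const
    · refine Filter.Eventually.of_forall fun θ _ => ?_
      have := (h (R * Complex.exp (θ * Complex.I)) (by
        simp [abs_of_pos hR, Complex.norm_exp_ofReal_mul_I])).mul_right
          (Complex.exp (-(k * θ * Complex.I)))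
      rw [zero_mul] at this
      refine (hasSum_congr_fun fun n => ?_).mp this
      simp only [F]
      rw [mul_zpow, ← Complex.exp_int_mul, ← mul_assoc, mul_assoc _ (Complex.exp _) (Complex.exp _),
        ← Complex.exp_add]
      congr 2
      push_cast; ring
  have hI : ∀ n, n ≠ k → ∫ θ in (0 : ℝ)..(2 * Real.pi), F n θ = 0 := by
    intro n hn
    simp only [F, intervalIntegral.integral_const_mul]
    have hc : (((n - k : ℤ) : ℂ) * Complex.I) ≠ 0 :=
      mul_ne_zero (by exact_mod_cast sub_ne_zero.mpr hn) Complex.I_ne_zero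
    have := integral_exp_mul_complex (a := 0) (b := 2 * Real.pi) hc
    rw [show (fun θ : ℝ => Complex.exp (((n - k : ℤ) : ℂ) * θ * Complex.I)) =
      fun θ : ℝ => Complex.exp (((n - k : ℤ) : ℂ) * Complex.I * θ) by
        funext θ; congr 1; ring, this]
    have h1 : Complex.exp (((n - k : ℤ) : ℂ) * Complex.I * ((2 * Real.pi : ℝ) : ℂ)) = 1 := by
      rw [← Complex.exp_int_mul_two_pi_mul_I (n - k)]
      congr 1; push_cast; ring
    rw [h1]; simp
  have := (hasSum_single k hI).unique hF
  simp only [F, sub_self, intervalIntegral.integral_zero] at this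
  simp only [Int.cast_zero, zero_mul, Complex.exp_zero, mul_one,
    intervalIntegral.integral_const, sub_zero, smul_eq_zero, mul_eq_zero] at this
  rcases this with h1 | h1 | h1
  · simp [Real.pi_ne_zero] at h1
  · exact h1
  · exact absurd h1 (zpow_ne_zero k (by exact_mod_cast hR.ne'))

/-! ### Euler products and their power series -/

/-- The product `∏_{n ≥ 1} (1 - x q ^ n)`. -/
noncomputable def eulerProd (q x : ℂ) : ℂ := ∏' n : ℕ, (1 - x * q ^ (n + 1))

theorem summable_mul_pow_succ {q : ℂ} (hq : ‖q‖ < 1) (C : ℝ) :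
    Summable fun n : ℕ => C * ‖q‖ ^ (n + 1) :=
  ((summable_nat_add_iff 1).mpr (summable_geometric_of_lt_one (norm_nonneg _) hq)).mul_left C

theorem multipliable_eulerProd {q : ℂ} (hq : ‖q‖ < 1) (x : ℂ) :
    Multipliable fun n : ℕ => 1 - x * q ^ (n + 1) := by
  simp_rw [sub_eq_add_neg]
  refine multipliable_one_add_of_summable ?_
  simpa using summable_mul_pow_succ hq ‖x‖

theorem eulerProd_eq {q : ℂ} (hq : ‖q‖ < 1) (x : ℂ) :
    eulerProd q x = (1 - x * q) * eulerProd q (x * q) := by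
  unfold eulerProd
  rw [tprod_eq_zero_mul']
  · simp only [zero_add, pow_one]
    congr 2; funext n; ring
  · convert multipliable_eulerProd hq (x * q) using 2 with n
    ring

theorem differentiable_eulerProd {q : ℂ} (hq : ‖q‖ < 1) : Differentiable ℂ (eulerProd q) := by
  intro x
  have h := Summable.hasProdLocallyUniformlyOn_nat_one_add (K := Metric.ball (0 : ℂ) (‖x‖ + 1))
    (f := fun n x => -(x * q ^ (n + 1))) Metric.isOpen_ball
    (summable_mul_pow_succ hq (‖x‖ + 1))
    (Filter.Eventually.of_forall fun n y hy => by
      simp only [norm_neg, norm_mul, norm_pow]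
      gcongr
      simpa using (mem_ball_zero_iff.mp hy).le)
    (fun n => by fun_prop)
  have hd := h.tendstoLocallyUniformlyOn_finsetRange.differentiableOn
    (Filter.Eventually.of_forall fun n => by fun_prop) Metric.isOpen_ball
  have hx : x ∈ Metric.ball (0 : ℂ) (‖x‖ + 1) := by simp
  have := hd.differentiableAt (Metric.isOpen_ball.mem_nhds hx)
  have he : eulerProd q = fun x => ∏' i : ℕ, (1 + -(x * q ^ (i + 1))) := by
    funext y
    simp only [eulerProd, sub_eq_add_neg]
  rw [he]
  exact this

theorem eulerProd_ne_zero {q : ℂ} (hq : ‖q‖ < 1) {x : ℂ} (hx : ‖x * q‖ < 1) :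
    eulerProd q x ≠ 0 := by
  have : eulerProd q x = ∏' n : ℕ, (1 + -(x * q ^ (n + 1))) := by
    simp only [eulerProd, sub_eq_add_neg]
  rw [this]
  refine tprod_one_add_ne_zero_of_summable (fun n => ?_) ?_
  · intro h0
    have h1 : x * q * q ^ n = 1 := by linear_combination -h0
    have h2 : ‖x * q * q ^ n‖ < 1 := by
      rw [norm_mul, norm_pow]
      exact mul_lt_one_of_nonneg_of_lt_one_left (norm_nonneg _) hx
        (pow_le_one₀ (norm_nonneg _) hq.le)
    rw [h1] at h2
    simp at h2
  · simpa using summable_mul_pow_succ hq ‖x‖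

theorem exists_hasSum_eulerProd {q : ℂ} (hq : ‖q‖ < 1) :
    ∃ h : ℕ → ℂ, ∀ x, HasSum (fun n => h n * x ^ n) (eulerProd q x) := by
  refine ⟨fun n => (n.factorial : ℂ)⁻¹ * iteratedDeriv n (eulerProd q) 0, fun x => ?_⟩
  have := Complex.hasSum_taylorSeries_of_entire (differentiable_eulerProd hq) 0 x
  refine (hasSum_congr_fun fun n => ?_).mpr this
  simp only [sub_zero, smul_eq_mul]
  ring

theorem exists_hasSum_inv_eulerProd {q : ℂ} (hq : ‖q‖ < 1) (hq0 : q ≠ 0) :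
    ∃ h : ℕ → ℂ, ∀ x, ‖x * q‖ < 1 → HasSum (fun n => h n * x ^ n) (eulerProd q x)⁻¹ := by
  refine ⟨fun n => (n.factorial : ℂ)⁻¹ * iteratedDeriv n (fun x => (eulerProd q x)⁻¹) 0,
    fun x hx => ?_⟩
  have hm : ∀ y, y ∈ Metric.ball (0 : ℂ) (‖q‖⁻¹) ↔ ‖y * q‖ < 1 := by
    intro y
    rw [mem_ball_zero_iff, norm_mul, ← lt_div_iff₀ (norm_pos_iff.mpr hq0), one_div]
  have := Complex.hasSum_taylorSeries_on_ball (c := 0) (r := ‖q‖⁻¹)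
    (f := fun x => (eulerProd q x)⁻¹)
    (fun y hy => ((differentiable_eulerProd hq y).inv
      (eulerProd_ne_zero hq ((hm y).mp hy))).differentiableWithinAt) ((hm x).mpr hx)
  refine (hasSum_congr_fun fun n => ?_).mpr this
  simp only [sub_zero, smul_eq_mul]
  ring

/-! ### The variable w = z^(-1/2) and fractional powers -/

/-- The variable `w` with `w ^ n = z ^ (-n / 2)`. -/
noncomputable def halfVar (u : ℂ) : ℂ := Complex.exp (-(Real.pi * Complex.I * u))

theorem halfVar_ne_zero (u : ℂ) : halfVar u ≠ 0 := Complex.exp_ne_zero _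

theorem halfVar_add (u v : ℂ) : halfVar (u + v) = halfVar u * halfVar v := by
  simp only [halfVar, ← Complex.exp_add]
  congr 1; ring

theorem halfVar_neg (u : ℂ) : halfVar (-u) = (halfVar u)⁻¹ := by
  simp only [halfVar, ← Complex.exp_neg]
  congr 1; ring

theorem halfVar_one : halfVar 1 = -1 := by
  rw [halfVar, mul_one, Complex.exp_neg, Complex.exp_pi_mul_I]; norm_num

theorem norm_halfVar (u : ℂ) : ‖halfVar u‖ = Real.exp (Real.pi * u.im) := by
  rw [halfVar, Complex.norm_exp]
  simp

theorem exists_halfVar_eq {w : ℂ} (hw : w ≠ 0) : ∃ u, halfVar u = w := by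
  refine ⟨Complex.I * Complex.log w / Real.pi, ?_⟩
  rw [halfVar]
  have : -(Real.pi * Complex.I * (Complex.I * Complex.log w / Real.pi)) = Complex.log w := by
    have : (Real.pi : ℂ) ≠ 0 := by exact_mod_cast Real.pi_ne_zero
    field_simp
    rw [Complex.I_sq]; ring
  rw [this, Complex.exp_log hw]

theorem halfVar_zpow (u : ℂ) (n : ℤ) : halfVar u ^ n = epow u (-(n : ℚ) / 2) := by
  rw [halfVar, ← Complex.exp_int_mul, epow]
  congr 1; push_cast; ring

theorem epow_add (x : ℂ) (a b : ℚ) : epow x (a + b) = epow x a * epow x b := by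
  simp only [epow, ← Complex.exp_add]
  congr 1; push_cast; ring

theorem epow_ne_zero (x : ℂ) (a : ℚ) : epow x a ≠ 0 := Complex.exp_ne_zero _

theorem epow_zero (x : ℂ) : epow x 0 = 1 := by simp [epow]

theorem epow_neg (x : ℂ) (a : ℚ) : epow x (-a) = (epow x a)⁻¹ := by
  simp only [epow, ← Complex.exp_neg]
  congr 1; push_cast; ring

theorem epow_sub (x : ℂ) (a b : ℚ) : epow x (a - b) = epow x a / epow x b := by
  rw [sub_eq_add_neg, epow_add, epow_neg, div_eq_mul_inv]

theorem epow_nat_mul (k : ℕ) (x : ℂ) (a : ℚ) : epow (k * x) a = epow x (k * a) := by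
  simp only [epow]
  congr 1; push_cast; ring

/-- Laurent coefficients are determined by the sum on a strip. -/
theorem laurent_unique {c d : ℤ → ℂ} {a b : ℝ} (hab : a < b) (F : ℂ → ℂ)
    (hc : ∀ u : ℂ, a < u.im → u.im < b → HasSum (fun n : ℤ => c n * halfVar u ^ n) (F u))
    (hd : ∀ u : ℂ, a < u.im → u.im < b → HasSum (fun n : ℤ => d n * halfVar u ^ n) (F u)) :
    c = d := by
  refine sub_eq_zero.mp (eq_zero_of_hasSum_laurent_zero
    (R := Real.exp (Real.pi * ((a + b) / 2))) (Real.exp_pos _) fun w hw => ?_)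
  obtain ⟨u, rfl⟩ := exists_halfVar_eq (w := w) (by
    rintro rfl
    simp [(Real.exp_pos _).ne] at hw)
  rw [norm_halfVar, Real.exp_eq_exp] at hw
  have hu := mul_left_cancel₀ Real.pi_ne_zero hw
  have := (hc u (by linarith) (by linarith)).sub (hd u (by linarith) (by linarith))
  rw [sub_self] at this
  refine (hasSum_congr_fun fun n => ?_).mpr this
  simp [sub_mul]

/-! ### Theta numerators: Laurent coefficients and transformation laws -/

/-- Completing the square identifies the terms, up to a constant factor, with those of the
two-variable Jacobi theta series. -/
theorem summable_gaussian_laurent {τ : ℂ} (hτ : 0 < τ.im) {a : ℚ} (ha : 0 < a) (b : ℚ) (u : ℂ)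
    (m : ℤ) : Summable fun j : ℤ => epow τ (a * (j + b) ^ 2) * halfVar u ^ (m * j) := by
  have h := (summable_jacobiTheta₂_term_iff (2 * a * b * τ - m * u / 2) (2 * a * τ)).mpr (by
    have : (2 * (a : ℂ) * τ) = ((2 * a : ℝ) : ℂ) * τ := by push_cast; ring
    rw [this, Complex.im_ofReal_mul]
    have : (0 : ℝ) < a := by exact_mod_cast ha
    positivity)
  refine (h.mul_left (epow τ (a * b ^ 2))).congr fun j => ?_
  rw [halfVar, ← Complex.exp_int_mul, epow, epow, jacobiTheta₂_term, ← Complex.exp_add,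
    ← Complex.exp_add]
  congr 1; push_cast; ring

/-- The numerator `∑_σ σ Θ_{σ s, p'}(z, q ^ p)`, `σ = ±1`. -/
noncomputable def thetaNumerator (p p' : ℕ) (s : ℤ) (u τ : ℂ) : ℂ :=
  classicalTheta s p' u ((p : ℂ) * τ) - classicalTheta (-s) p' u ((p : ℂ) * τ)

/-- The coefficient of `z ^ (-n / 2)` in `Θ_{s, p'}(z, q ^ p)`. -/
noncomputable def thetaCoeffHalf (p p' : ℕ) (s : ℤ) (τ : ℂ) (n : ℤ) : ℂ :=
  (if (2 * p' : ℤ) ∣ n - s then 1 else 0) * epow τ ((p : ℚ) * n ^ 2 / (4 * p'))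

/-- The coefficient of `z ^ (-n / 2)` in `∑_σ σ Θ_{σ s, p'}(z, q ^ p)`. -/
noncomputable def thetaCoeff (p p' : ℕ) (s : ℤ) (τ : ℂ) (n : ℤ) : ℂ :=
  thetaCoeffHalf p p' s τ n - thetaCoeffHalf p p' (-s) τ n

theorem hasSum_classicalTheta {p p' : ℕ} (hp : 1 ≤ p) (hp' : 1 ≤ p') (s : ℤ) {τ : ℂ}
    (hτ : 0 < τ.im) (u : ℂ) :
    HasSum (fun n : ℤ => thetaCoeffHalf p p' s τ n * halfVar u ^ n)
      (classicalTheta s p' u ((p : ℂ) * τ)) := by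
  have hp'0 : (p' : ℚ) ≠ 0 := by positivity
  have hi : Function.Injective fun j : ℤ => 2 * (p' : ℤ) * j + s := by
    intro a b h
    have : (2 * (p' : ℤ)) ≠ 0 := by positivity
    simpa [this] using h
  rw [← hi.hasSum_iff]
  · have hs : Summable fun j : ℤ => epow (p * τ) ((p' : ℚ) * ((j : ℚ) + (s : ℚ) / (2 * (p' : ℚ))) ^ 2) *
        epow u (-((p' : ℚ) * ((j : ℚ) + (s : ℚ) / (2 * (p' : ℚ))))) := by
      refine ((summable_gaussian_laurent hτ (a := p * p') (by positivity) (s / (2 * p')) u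
        (2 * p')).mul_right (epow u (-(s / 2 : ℚ)))).congr fun j => ?_
      rw [mul_assoc, halfVar_zpow, ← epow_add, epow_nat_mul]
      congr 2
      · ring
      · push_cast; field_simp; ring
    refine (hasSum_congr_fun fun j => ?_).mpr hs.hasSum
    simp only [Function.comp, thetaCoeffHalf, add_sub_cancel_right, dvd_mul_right, if_true, one_mul]
    rw [halfVar_zpow, epow_nat_mul]
    congr 2
    · push_cast; field_simp; ring
    · push_cast; field_simp
  · intro n hn
    have : ¬ (2 * p' : ℤ) ∣ n - s := by
      rintro ⟨k, hk⟩
      exact hn ⟨k, by simp only; linarith⟩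
    simp [thetaCoeffHalf, this]

theorem hasSum_thetaNumerator {p p' : ℕ} (hp : 1 ≤ p) (hp' : 1 ≤ p') (s : ℤ) {τ : ℂ}
    (hτ : 0 < τ.im) (u : ℂ) :
    HasSum (fun n : ℤ => thetaCoeff p p' s τ n * halfVar u ^ n) (thetaNumerator p p' s u τ) := by
  refine (hasSum_congr_fun fun n => ?_).mpr
    ((hasSum_classicalTheta hp hp' s hτ u).sub (hasSum_classicalTheta hp hp' (-s) hτ u))
  rw [thetaCoeff, sub_mul]

theorem thetaCoeffHalf_neg (p p' : ℕ) (s : ℤ) (τ : ℂ) (n : ℤ) :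
    thetaCoeffHalf p p' s τ (-n) = thetaCoeffHalf p p' (-s) τ n := by
  unfold thetaCoeffHalf
  have e : (2 * p' : ℤ) ∣ -n - s ↔ (2 * p' : ℤ) ∣ n - -s := by
    rw [← dvd_neg, show -(-n - s) = n - -s by ring]
  simp only [e, Int.cast_neg, neg_sq]

theorem thetaCoeff_neg (p p' : ℕ) (s : ℤ) (τ : ℂ) (n : ℤ) :
    thetaCoeff p p' s τ (-n) = -thetaCoeff p p' s τ n := by
  rw [thetaCoeff, thetaCoeff, thetaCoeffHalf_neg, thetaCoeffHalf_neg, neg_neg, neg_sub]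

theorem thetaCoeffHalf_eq_zero_of_odd {p p' : ℕ} {s : ℤ} {τ : ℂ} {n : ℤ} (h : ¬ Even (n - s)) :
    thetaCoeffHalf p p' s τ n = 0 := by
  have : ¬ (2 * p' : ℤ) ∣ n - s := fun hd => h (even_iff_two_dvd.mpr ((dvd_mul_right _ _).trans hd))
  simp [thetaCoeffHalf, this]

theorem thetaCoeff_eq_zero_of_odd {p p' : ℕ} {s : ℤ} {τ : ℂ} {n : ℤ} (h : ¬ Even (n - s)) :
    thetaCoeff p p' s τ n = 0 := by
  have h' : ¬ Even (n - -s) := by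
    rw [sub_neg_eq_add]; rwa [Int.even_sub, ← Int.even_add] at h
  rw [thetaCoeff, thetaCoeffHalf_eq_zero_of_odd h, thetaCoeffHalf_eq_zero_of_odd h', sub_zero]

theorem thetaNumerator_neg {p p' : ℕ} (hp : 1 ≤ p) (hp' : 1 ≤ p') (s : ℤ) {τ : ℂ}
    (hτ : 0 < τ.im) (u : ℂ) :
    thetaNumerator p p' s (-u) τ = -thetaNumerator p p' s u τ := by
  have h := hasSum_thetaNumerator hp hp' s hτ (-u)
  simp only [halfVar_neg] at h
  refine (hasSum_laurent_inv h).unique ((hasSum_congr_fun fun n => ?_).mpr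
    (hasSum_thetaNumerator hp hp' s hτ u).neg)
  rw [thetaCoeff_neg, neg_mul]

theorem thetaNumerator_add_one {p p' : ℕ} (hp : 1 ≤ p) (hp' : 1 ≤ p') (s : ℤ) {τ : ℂ}
    (hτ : 0 < τ.im) (u : ℂ) :
    thetaNumerator p p' s (u + 1) τ = (-1) ^ s * thetaNumerator p p' s u τ := by
  refine (hasSum_thetaNumerator hp hp' s hτ (u + 1)).unique ((hasSum_congr_fun fun n => ?_).mpr
    ((hasSum_thetaNumerator hp hp' s hτ u).mul_left ((-1) ^ s)))
  rw [halfVar_add, halfVar_one, mul_zpow]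
  by_cases h : Even (n - s)
  · rw [show n = s + (n - s) by ring, zpow_add₀ (by norm_num : (-1 : ℂ) ≠ 0), h.neg_one_zpow]
    ring_nf
  · rw [thetaCoeff_eq_zero_of_odd h]; simp

/-- The shift moves n by 2p'k, which preserves the residue classes of ±s modulo 2p'; the exponents
of q agree after completing the square. -/
theorem thetaNumerator_add_period {p p' : ℕ} (hp : 1 ≤ p) (hp' : 1 ≤ p') (s : ℤ) {τ : ℂ}
    (hτ : 0 < τ.im) (k : ℕ) (u : ℂ) :
    thetaNumerator p p' s (u + 2 * p * k * τ) τ =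
      epow τ (-(p * p' * k ^ 2)) * (halfVar u ^ (2 * p' * k : ℤ) * thetaNumerator p p' s u τ) := by
  refine (hasSum_thetaNumerator hp hp' s hτ _).unique ((hasSum_congr_fun fun n => ?_).mpr
    ((hasSum_laurent_shift (halfVar_ne_zero u)
      (hasSum_thetaNumerator hp hp' s hτ u) (2 * p' * k)).mul_left _))
  have hp'0 : (p' : ℚ) ≠ 0 := by positivity
  have key : ∀ s, thetaCoeffHalf p p' s τ n * halfVar (2 * p * k * τ) ^ n =
      epow τ (-(p * p' * k ^ 2)) * thetaCoeffHalf p p' s τ (n - 2 * p' * k) := by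
    intro s
    unfold thetaCoeffHalf
    have e : ((2 * p' : ℤ) ∣ n - 2 * p' * k - s) ↔ ((2 * p' : ℤ) ∣ n - s) := by
      rw [show n - 2 * p' * k - s = n - s - 2 * p' * k by ring]
      exact dvd_sub_left (dvd_mul_right _ _)
    simp only [e]
    rw [mul_left_comm (epow _ _), mul_assoc, ← epow_add, halfVar_zpow,
      show (2 * p * k * τ : ℂ) = ((2 * p * k : ℕ) : ℂ) * τ by push_cast; ring, epow_nat_mul,
      ← epow_add]
    congr 2
    push_cast; field_simp; ring
  rw [halfVar_add, mul_zpow, thetaCoeff, thetaCoeff]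
  linear_combination halfVar u ^ n * key s - halfVar u ^ n * key (-s)

/-- For p = 1 a half-period is available: n ↦ n - P carries the class of r to that of -(P - r) and
the class of -r to that of P - r, whence the sign. -/
theorem thetaCoeff_mul_halfVar {P : ℕ} (hP : 1 ≤ P) (r : ℤ) (τ : ℂ) (n : ℤ) :
    thetaCoeff 1 P r τ n * halfVar τ ^ n =
      -epow τ (-(P / 4)) * thetaCoeff 1 P (P - r) τ (n - P) := by
  have hP0 : (P : ℚ) ≠ 0 := by positivity
  have key : ∀ r r' : ℤ, (((2 * P : ℤ) ∣ n - r) ↔ ((2 * P : ℤ) ∣ n - P - r')) →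
      thetaCoeffHalf 1 P r τ n * halfVar τ ^ n =
      epow τ (-(P / 4)) * thetaCoeffHalf 1 P r' τ (n - P) := by
    intro r r' e
    unfold thetaCoeffHalf
    simp only [e]
    rw [mul_left_comm (epow _ _), mul_assoc, ← epow_add, halfVar_zpow, ← epow_add]
    congr 2
    push_cast; field_simp; ring
  have h1 := key r (-(P - r)) (by rw [show n - P - -(P - r) = n - r by ring])
  have h2 := key (-r) (P - r) (by
    rw [show n - P - (P - r) = n - -r - 2 * P by ring]
    exact (dvd_sub_left (dvd_refl _)).symm)
  rw [thetaCoeff, thetaCoeff]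
  linear_combination h1 - h2

theorem thetaNumerator_add_tau {P : ℕ} (hP : 1 ≤ P) (r : ℤ) {τ : ℂ} (hτ : 0 < τ.im) (u : ℂ) :
    thetaNumerator 1 P r (u + τ) τ =
      -epow τ (-(P / 4)) * (halfVar u ^ (P : ℤ) * thetaNumerator 1 P (P - r) u τ) := by
  refine (hasSum_thetaNumerator le_rfl hP r hτ _).unique ((hasSum_congr_fun fun n => ?_).mpr
    ((hasSum_laurent_shift (halfVar_ne_zero u)
      (hasSum_thetaNumerator le_rfl hP (P - r) hτ u) P).mul_left _))
  rw [halfVar_add, mul_zpow]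
  linear_combination halfVar u ^ n * thetaCoeff_mul_halfVar hP r τ n

/-! ### Jacobi triple product and nonvanishing of the Weyl denominator -/

theorem halfVar_tau_sq_mul (τ : ℂ) : halfVar τ ^ 2 * epow τ 1 = 1 := by
  have := halfVar_zpow τ 2
  rw [zpow_ofNat] at this
  rw [this, ← epow_add]
  norm_num [epow_zero]

theorem norm_epow_one_lt_one {τ : ℂ} (hτ : 0 < τ.im) : ‖epow τ 1‖ < 1 := by
  have h := congrArg norm (halfVar_tau_sq_mul τ)
  rw [norm_mul, norm_pow, norm_halfVar, norm_one] at h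
  have h1 : 1 < Real.exp (Real.pi * τ.im) := Real.one_lt_exp_iff.mpr (by positivity)
  have h2 : 1 < Real.exp (Real.pi * τ.im) ^ 2 := one_lt_pow₀ h1 two_ne_zero
  nlinarith [norm_nonneg (epow τ 1)]

/-- The product side of the Jacobi triple product identity. -/
noncomputable def tripleProduct (u τ : ℂ) : ℂ :=
  ((halfVar u)⁻¹ - halfVar u) *
    (eulerProd (epow τ 1) (halfVar u ^ 2) * eulerProd (epow τ 1) ((halfVar u)⁻¹ ^ 2))

theorem tripleProduct_add_tau {τ : ℂ} (hτ : 0 < τ.im) (u : ℂ) :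
    tripleProduct (u + τ) τ = -halfVar τ * (halfVar u ^ 2 * tripleProduct u τ) := by
  have hq := norm_epow_one_lt_one hτ
  have hk := halfVar_tau_sq_mul τ
  have hw0 := halfVar_ne_zero u
  have hk0 := halfVar_ne_zero τ
  unfold tripleProduct
  rw [halfVar_add]
  set q := epow τ 1
  set w := halfVar u
  set κ := halfVar τ
  have hq1 : q = κ⁻¹ ^ 2 := by field_simp; linear_combination hk
  rw [eulerProd_eq hq ((w * κ) ^ 2), eulerProd_eq hq (w⁻¹ ^ 2),
    show (w * κ) ^ 2 * q = w ^ 2 by linear_combination w ^ 2 * hk,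
    show (w * κ)⁻¹ ^ 2 = w⁻¹ ^ 2 * q by rw [hq1, mul_inv]; ring]
  have : ((w * κ)⁻¹ - w * κ) * (1 - w ^ 2) =
      -κ * w ^ 2 * (w⁻¹ - w) * (1 - w⁻¹ ^ 2 * q) := by
    rw [hq1]; field_simp; ring
  linear_combination (eulerProd q (w ^ 2) * eulerProd q (w⁻¹ ^ 2 * q)) * this

theorem tripleProduct_add_one (u τ : ℂ) : tripleProduct (u + 1) τ = -tripleProduct u τ := by
  unfold tripleProduct
  rw [halfVar_add, halfVar_one, mul_neg_one, inv_neg, neg_sq, neg_sq]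
  ring

theorem one_lt_norm_halfVar {u : ℂ} (hu : 0 < u.im) : 1 < ‖halfVar u‖ := by
  rw [norm_halfVar]
  exact Real.one_lt_exp_iff.mpr (by positivity)

theorem inv_sub_ne_zero_of_one_lt_norm {w : ℂ} (hw : 1 < ‖w‖) : w⁻¹ - w ≠ 0 := by
  intro h
  have h1 := congrArg norm (sub_eq_zero.mp h)
  rw [norm_inv] at h1
  exact absurd h1 ((inv_lt_one_of_one_lt₀ hw).trans hw).ne

theorem norm_halfVar_sq_mul_lt_one {u τ : ℂ} (hu : u.im < τ.im) :
    ‖halfVar u ^ 2 * epow τ 1‖ < 1 := by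
  have h := congrArg norm (halfVar_tau_sq_mul τ)
  rw [norm_one, norm_mul, norm_pow] at h
  rw [← h, norm_mul, norm_pow, norm_halfVar, norm_halfVar]
  have : 0 < ‖epow τ 1‖ := norm_pos_iff.mpr (epow_ne_zero _ _)
  gcongr

theorem norm_inv_halfVar_sq_mul_lt_one {u τ : ℂ} (hu : 0 < u.im) (hu' : u.im < τ.im) :
    ‖(halfVar u)⁻¹ ^ 2 * epow τ 1‖ < 1 := by
  rw [← halfVar_neg]
  exact norm_halfVar_sq_mul_lt_one (by rw [Complex.neg_im]; linarith)

theorem tripleProduct_ne_zero {u τ : ℂ} (hu : 0 < u.im) (hu' : u.im < τ.im) :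
    tripleProduct u τ ≠ 0 := by
  have hq := norm_epow_one_lt_one (hu.trans hu')
  exact mul_ne_zero (inv_sub_ne_zero_of_one_lt_norm (one_lt_norm_halfVar hu))
    (mul_ne_zero (eulerProd_ne_zero hq (norm_halfVar_sq_mul_lt_one hu'))
      (eulerProd_ne_zero hq (norm_inv_halfVar_sq_mul_lt_one hu hu')))

theorem two_mul_natCast_injective : Function.Injective fun n : ℕ => 2 * (n : ℤ) := by
  intro a b h
  simpa using h

theorem hasSum_laurent_of_sq {h : ℕ → ℂ} {w f : ℂ} (hf : HasSum (fun n => h n * (w ^ 2) ^ n) f) :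
    HasSum (fun n : ℤ => Function.extend (fun n : ℕ => 2 * (n : ℤ)) h 0 n * w ^ n) f := by
  refine hasSum_laurent_of_injective two_mul_natCast_injective ((hasSum_congr_fun fun n => ?_).mpr hf)
  rw [zpow_mul, zpow_natCast, zpow_ofNat]

theorem exists_hasSum_tripleProduct {τ : ℂ} (hτ : 0 < τ.im) :
    ∃ t : ℤ → ℂ, ∀ u, HasSum (fun n : ℤ => t n * halfVar u ^ n) (tripleProduct u τ) := by
  obtain ⟨h, hh⟩ := exists_hasSum_eulerProd (norm_epow_one_lt_one hτ)
  set a := Function.extend (fun n : ℕ => 2 * (n : ℤ)) h 0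
  set m := laurentMul a (fun n => a (-n))
  refine ⟨fun n => m (n - -1) - m (n - 1), fun u => ?_⟩
  have hw := halfVar_ne_zero u
  have hm := (HasSum.laurentMul hw (hasSum_laurent_of_sq (hh (halfVar u ^ 2)))
    (hasSum_laurent_inv (hasSum_laurent_of_sq (hh ((halfVar u)⁻¹ ^ 2))))).2
  have := (hasSum_laurent_shift hw hm (-1)).sub (hasSum_laurent_shift hw hm 1)
  rw [zpow_neg_one, zpow_one, ← sub_mul] at this
  refine (hasSum_congr_fun fun n => ?_).mpr this
  rw [sub_mul]

theorem eq_zero_of_recursion {e : ℤ → ℂ} {κ : ℂ} (hκ : κ ≠ 0)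
    (h : ∀ n, e n * κ ^ n = -κ * e (n - 2)) (h1 : e 1 = 0) (he : ∀ n, Even n → e n = 0) (n : ℤ) :
    e n = 0 := by
  rcases Int.even_or_odd n with hn | ⟨k, rfl⟩
  · exact he n hn
  induction k using Int.induction_on with
  | zero => simpa using h1
  | succ k ih =>
    have := h (2 * (k + 1) + 1)
    rw [show (2 * (k + 1) + 1 - 2 : ℤ) = 2 * k + 1 by ring, ih, mul_zero] at this
    exact (mul_eq_zero.mp this).resolve_right (zpow_ne_zero _ hκ)
  | pred k ih =>
    have := h (2 * -k + 1)
    rw [show (2 * -k + 1 - 2 : ℤ) = 2 * (-k - 1) + 1 by ring, ih, zero_mul] at this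
    exact (mul_eq_zero.mp this.symm).resolve_left (neg_ne_zero.mpr hκ)

theorem thetaCoeff_one_ne_zero (τ : ℂ) : thetaCoeff 1 2 1 τ 1 ≠ 0 := by
  have : ¬ (4 : ℤ) ∣ 2 := by decide
  norm_num [thetaCoeff, thetaCoeffHalf, this, epow_ne_zero]

/-- The Jacobi triple product identity, up to a constant factor. -/
theorem exists_weylDenominator_eq {τ : ℂ} (hτ : 0 < τ.im) :
    ∃ C : ℂ, C ≠ 0 ∧ ∀ u, thetaNumerator 1 2 1 u τ = C * tripleProduct u τ := by
  obtain ⟨t, ht⟩ := exists_hasSum_tripleProduct hτ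
  -- Both sides obey the same laws under u ↦ u + τ and u ↦ u + 1. On coefficients these give a
  -- two-step recursion and vanishing at even n, so everything is determined by the coefficient at
  -- 1.
  set d := thetaCoeff 1 2 1 τ
  have hd : ∀ u, HasSum (fun n : ℤ => d n * halfVar u ^ n) (thetaNumerator 1 2 1 u τ) :=
    hasSum_thetaNumerator le_rfl one_le_two 1 hτ
  have hκ := halfVar_ne_zero τ
  have hdr : ∀ n, d n * halfVar τ ^ n = -halfVar τ * d (n - 2) := by
    intro n
    have := thetaCoeff_mul_halfVar one_le_two 1 τ n
    have h2 := halfVar_zpow τ 1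
    rw [zpow_one, show (-((1 : ℤ) : ℚ) / 2) = -((2 : ℕ) / 4) by norm_num] at h2
    rwa [← h2] at this
  have htr : ∀ n, t n * halfVar τ ^ n = -halfVar τ * t (n - 2) := by
    have := laurent_unique (c := fun n => t n * halfVar τ ^ n)
      (d := fun n => -halfVar τ * t (n - 2)) zero_lt_one (fun u => tripleProduct (u + τ) τ)
      (fun u _ _ => hasSum_laurent_mul (by rw [← halfVar_add]; exact ht (u + τ)))
      (fun u _ _ => by
        have := (hasSum_laurent_shift (halfVar_ne_zero u) (ht u) 2).mul_left (-halfVar τ)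
        rw [tripleProduct_add_tau hτ]
        refine (hasSum_congr_fun fun n => ?_).mpr this
        ring)
    exact congrFun this
  have hte : ∀ n, Even n → t n = 0 := by
    intro n hn
    have := laurent_unique (c := fun n => t n * halfVar 1 ^ n)
      (d := fun n => -t n) zero_lt_one (fun u => tripleProduct (u + 1) τ)
      (fun u _ _ => hasSum_laurent_mul (by rw [← halfVar_add]; exact ht (u + 1)))
      (fun u _ _ => by
        rw [tripleProduct_add_one]
        refine (hasSum_congr_fun fun n => ?_).mpr (ht u).neg
        ring)
    have := congrFun this n
    simp only [halfVar_one, hn.neg_one_zpow, mul_one] at this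
    exact self_eq_neg.mp this
  have hde : ∀ n, Even n → d n = 0 := fun n hn =>
    thetaCoeff_eq_zero_of_odd (by rw [Int.even_sub]; simp [hn])
  have hd1 : d 1 ≠ 0 := thetaCoeff_one_ne_zero τ
  have he := eq_zero_of_recursion (e := fun n => t n * d 1 - t 1 * d n) hκ
    (fun n => by linear_combination d 1 * htr n - t 1 * hdr n) (by ring)
    (fun n hn => by simp [hte n hn, hde n hn])
  have key : ∀ u, tripleProduct u τ * d 1 = t 1 * thetaNumerator 1 2 1 u τ := fun u =>
    ((ht u).mul_right (d 1)).unique ((hasSum_congr_fun fun n => by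
      linear_combination halfVar u ^ n * he n).mpr ((hd u).mul_left (t 1)))
  -- Otherwise the product would vanish identically, but it is nonzero at τ/2, inside the strip.
  have ht1 : t 1 ≠ 0 := by
    intro h0
    have := key (τ / 2)
    rw [h0, zero_mul] at this
    have him : (τ / 2).im = τ.im / 2 := by simp
    exact mul_ne_zero (tripleProduct_ne_zero (by rw [him]; linarith) (by rw [him]; linarith)) hd1 this
  refine ⟨d 1 / t 1, div_ne_zero hd1 ht1, fun u => ?_⟩
  field_simp
  linear_combination -key u

theorem weylDenominator_ne_zero {u τ : ℂ} (hu : 0 < u.im) (hu' : u.im < τ.im) :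
    thetaNumerator 1 2 1 u τ ≠ 0 := by
  obtain ⟨C, hC, h⟩ := exists_weylDenominator_eq (hu.trans hu')
  rw [h]
  exact mul_ne_zero hC (tripleProduct_ne_zero hu hu')

/-! ### Even Laurent expansions of theta quotients -/

/-- The quotient `∑_σ σ Θ_{σ s, p'}(z, q ^ p) / ∑_σ σ Θ_{σ, 2}(z, q)`. -/
noncomputable def thetaRatio (p p' : ℕ) (s : ℤ) (u τ : ℂ) : ℂ :=
  thetaNumerator p p' s u τ / thetaNumerator 1 2 1 u τ

theorem affineCharacter_eq (p p' ℓ : ℕ) (u τ : ℂ) :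
    affineCharacter p p' ℓ u τ = thetaRatio p p' (ℓ + 1) u τ := by
  simp [affineCharacter, thetaRatio, thetaNumerator]

/-- Division of an odd Laurent series by `w⁻¹ - w` gives an even one. -/
theorem exists_even_hasSum_div {a : ℤ → ℂ} {F : ℂ → ℂ} (ha : ∀ n, a (-n) = -a n)
    (hF : ∀ u : ℂ, 0 < u.im → HasSum (fun n : ℤ => a n * halfVar u ^ n) (F u)) :
    ∃ b : ℤ → ℂ, (∀ n, b (-n) = b n) ∧ ∀ u : ℂ, 0 < u.im →
      HasSum (fun n : ℤ => b n * halfVar u ^ n) (F u / ((halfVar u)⁻¹ - halfVar u)) := by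
  -- For |w| > 1, 1/(w⁻¹ - w) is the geometric series -∑ w^(-1-2k).
  set i : ℕ → ℤ := fun k => -1 - 2 * k
  have hi : i.Injective := by
    intro k l h
    simp only [i] at h
    lia
  set e : ℤ → ℂ := Function.extend i (fun _ => -1) 0
  have hE : ∀ u : ℂ, 0 < u.im →
      HasSum (fun n : ℤ => e n * halfVar u ^ n) ((halfVar u)⁻¹ - halfVar u)⁻¹ := by
    intro u hu
    have hw1 := one_lt_norm_halfVar hu
    have hw0 := halfVar_ne_zero u
    have hne := inv_sub_ne_zero_of_one_lt_norm hw1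
    refine hasSum_laurent_of_injective hi ?_
    have hn : ‖(halfVar u)⁻¹ ^ 2‖ < 1 := by
      rw [norm_pow, norm_inv]
      exact pow_lt_one₀ (by positivity) (inv_lt_one_of_one_lt₀ hw1) two_ne_zero
    have := (hasSum_geometric_of_norm_lt_one hn).mul_left (-(halfVar u)⁻¹)
    have hv : -(halfVar u)⁻¹ * (1 - (halfVar u)⁻¹ ^ 2)⁻¹ = ((halfVar u)⁻¹ - halfVar u)⁻¹ := by
      have : (halfVar u)⁻¹ - halfVar u = -halfVar u * (1 - (halfVar u)⁻¹ ^ 2) := by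
        field_simp; ring
      rw [this, mul_inv, neg_inv]
    rw [hv] at this
    refine (hasSum_congr_fun fun n => ?_).mpr this
    simp only [i]
    rw [show (-1 - 2 * n : ℤ) = -(1 + (2 * n : ℕ)) by push_cast; ring, zpow_neg, ← inv_zpow,
      zpow_add₀ (inv_ne_zero hw0), zpow_natCast, pow_mul, zpow_one]
    ring
  set b := laurentMul a e
  have hb : ∀ u : ℂ, 0 < u.im →
      HasSum (fun n : ℤ => b n * halfVar u ^ n) (F u / ((halfVar u)⁻¹ - halfVar u)) :=
    fun u hu => (HasSum.laurentMul (halfVar_ne_zero u) (hF u hu) (hE u hu)).2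
  have hrec : ∀ n, b (n - -1) - b (n - 1) = a n := by
    refine congrFun (laurent_unique zero_lt_one F (fun u hu _ => ?_) (fun u hu _ => hF u hu))
    have hw := halfVar_ne_zero u
    have := (hasSum_laurent_shift hw (hb u hu) (-1)).sub (hasSum_laurent_shift hw (hb u hu) 1)
    rw [zpow_neg_one, zpow_one, ← sub_mul,
      mul_div_cancel₀ _ (inv_sub_ne_zero_of_one_lt_norm (one_lt_norm_halfVar hu))] at this
    refine (hasSum_congr_fun fun n => ?_).mpr this
    rw [sub_mul]
  refine ⟨b, ?_, hb⟩
  -- Adding the recursion at n and at -n cancels the odd a, so b(n) - b(-n) has period 2; it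
  -- vanishes at 0, and at 1 because it is odd.
  have hper : ∀ n, b (n + 1) - b (-(n + 1)) = b (n - 1) - b (-(n - 1)) := by
    intro n
    have h1 := hrec n
    have h2 := hrec (-n)
    rw [ha] at h2
    rw [show n - -1 = n + 1 by ring] at h1
    rw [show -n - -1 = -(n - 1) by ring, show -n - 1 = -(n + 1) by ring] at h2
    linear_combination h1 + h2
  have hd : ∀ k : ℤ, b (2 * k) - b (-(2 * k)) = 0 ∧ b (2 * k + 1) - b (-(2 * k + 1)) = 0 := by
    intro k
    induction k using Int.induction_on with
    | zero =>
      refine ⟨by simp, ?_⟩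
      have := hper 0
      norm_num at this ⊢
      linear_combination this / 2
    | succ k ih =>
      have h1 := hper (2 * k + 1)
      have h2 := hper (2 * k + 2)
      rw [show (2 * k + 1 + 1 : ℤ) = 2 * (k + 1) by ring,
        show (2 * k + 1 - 1 : ℤ) = 2 * k by ring, ih.1] at h1
      rw [show (2 * k + 2 + 1 : ℤ) = 2 * (k + 1) + 1 by ring,
        show (2 * k + 2 - 1 : ℤ) = 2 * k + 1 by ring, ih.2] at h2
      exact ⟨h1, h2⟩
    | pred k ih =>
      have h1 := hper (2 * -k - 1)
      have h2 := hper (2 * -k)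
      rw [show (2 * -k - 1 - 1 : ℤ) = 2 * (-k - 1) by ring,
        show (2 * -k - 1 + 1 : ℤ) = 2 * -k by ring, ih.1] at h1
      rw [show (2 * -k - 1 : ℤ) = 2 * (-k - 1) + 1 by ring, ih.2] at h2
      exact ⟨h1.symm, h2.symm⟩
  intro n
  rcases Int.even_or_odd' n with ⟨k, rfl | rfl⟩
  · exact (sub_eq_zero.mp (hd k).1).symm
  · exact (sub_eq_zero.mp (hd k).2).symm

/-- By the triple product, dividing by the denominator means dividing by w⁻¹ - w, which makes the
odd numerator even, and by two Euler products in w² and w⁻². The reciprocals of the latter are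
reflections of each other, so their product is even too. -/
theorem exists_even_hasSum_thetaRatio {p p' : ℕ} (hp : 1 ≤ p) (hp' : 1 ≤ p') (s : ℤ) {τ : ℂ}
    (hτ : 0 < τ.im) :
    ∃ c : ℤ → ℂ, (∀ n, c (-n) = c n) ∧ ∀ u : ℂ, 0 < u.im → u.im < τ.im →
      HasSum (fun n : ℤ => c n * halfVar u ^ n) (thetaRatio p p' s u τ) := by
  obtain ⟨C, hC, hD⟩ := exists_weylDenominator_eq hτ
  obtain ⟨b, hbe, hb⟩ := exists_even_hasSum_div (thetaCoeff_neg p p' s τ)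
    (fun u _ => hasSum_thetaNumerator hp hp' s hτ u)
  obtain ⟨h, hh⟩ := exists_hasSum_inv_eulerProd (norm_epow_one_lt_one hτ) (epow_ne_zero τ 1)
  set a := Function.extend (fun n : ℕ => 2 * (n : ℤ)) h 0
  refine ⟨fun n => laurentMul b (laurentMul a (fun n => a (-n))) n * C⁻¹, fun n => ?_,
    fun u hu hu' => ?_⟩
  · simp only
    rw [laurentMul_even hbe (laurentMul_reflect_even a)]
  have hw := halfVar_ne_zero u
  have hm := (HasSum.laurentMul hw
    (hasSum_laurent_of_sq (hh (halfVar u ^ 2) (norm_halfVar_sq_mul_lt_one hu')))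
    (hasSum_laurent_inv (hasSum_laurent_of_sq (hh ((halfVar u)⁻¹ ^ 2)
      (norm_inv_halfVar_sq_mul_lt_one hu hu'))))).2
  have := (HasSum.laurentMul hw (hb u hu) hm).2.mul_right C⁻¹
  convert (hasSum_congr_fun fun n => ?_).mpr this using 1
  · rw [thetaRatio, hD, tripleProduct]
    simp only [div_eq_mul_inv, mul_inv]
    ring
  · ring

theorem thetaRatio_add_tau {P : ℕ} (hP : 1 ≤ P) (r : ℤ) {τ : ℂ} (hτ : 0 < τ.im) (u : ℂ) :
    thetaRatio 1 P r (u + τ) τ =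
      epow τ (-(P / 4)) / epow τ (-((2 : ℕ) / 4)) *
        (halfVar u ^ (P - 2 : ℤ) * thetaRatio 1 P (P - r) u τ) := by
  rw [thetaRatio, thetaRatio, thetaNumerator_add_tau hP r hτ u,
    thetaNumerator_add_tau one_le_two 1 hτ u, zpow_sub₀ (halfVar_ne_zero u)]
  have h1 := epow_ne_zero τ (-((2 : ℕ) / 4))
  have h2 := halfVar_ne_zero u
  norm_num only [Nat.cast_ofNat]
  rw [neg_mul, neg_mul, neg_div_neg_eq]
  simp only [div_eq_mul_inv, mul_inv]
  ring

theorem thetaRatio_neg {p p' : ℕ} (hp : 1 ≤ p) (hp' : 1 ≤ p') (s : ℤ) {τ : ℂ}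
    (hτ : 0 < τ.im) (u : ℂ) : thetaRatio p p' s (-u) τ = thetaRatio p p' s u τ := by
  rw [thetaRatio, thetaNumerator_neg hp hp' s hτ, thetaNumerator_neg le_rfl one_le_two 1 hτ,
    neg_div_neg_eq, thetaRatio]

theorem thetaRatio_add_one {p p' : ℕ} (hp : 1 ≤ p) (hp' : 1 ≤ p') (s : ℤ) {τ : ℂ}
    (hτ : 0 < τ.im) (u : ℂ) :
    thetaRatio p p' s (u + 1) τ = (-1) ^ (s - 1) * thetaRatio p p' s u τ := by
  rw [thetaRatio, thetaNumerator_add_one hp hp' s hτ, thetaNumerator_add_one le_rfl one_le_two 1 hτ,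
    zpow_sub₀ (by norm_num), thetaRatio, mul_div_mul_comm]

/-- The shift u ↦ u + 1 replaces w by -w. -/
theorem laurent_eq_zero_of_odd {c : ℤ → ℂ} {t : ℝ} (ht : 0 < t) {F : ℂ → ℂ} {s : ℤ}
    (hc : ∀ u : ℂ, 0 < u.im → u.im < t → HasSum (fun n : ℤ => c n * halfVar u ^ n) (F u))
    (hF : ∀ u, F (u + 1) = (-1) ^ s * F u) {n : ℤ} (hn : ¬ Even (n - s)) : c n = 0 := by
  have h := congrFun (laurent_unique (c := fun n => c n * halfVar 1 ^ n)
    (d := fun n => (-1) ^ s * c n) ht (fun u => F (u + 1))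
    (fun u hu hu' => hasSum_laurent_mul (by
      rw [← halfVar_add]; exact hc (u + 1) (by simpa using hu) (by simpa using hu')))
    (fun u hu hu' => by
      rw [hF]
      refine (hasSum_congr_fun fun n => ?_).mpr ((hc u hu hu').mul_left ((-1) ^ s))
      ring)) n
  have h1 : (-1 : ℂ) ^ n = (-1) ^ s * (-1) ^ (n - s) := by
    rw [← zpow_add₀ (by norm_num)]; congr 1; ring
  simp only [halfVar_one] at h
  rw [h1, (Int.not_even_iff_odd.mp hn).neg_one_zpow] at h
  have h3 : (-1 : ℂ) ^ s ≠ 0 := zpow_ne_zero _ (by norm_num)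
  have h4 : (-1 : ℂ) ^ s * c n = 0 := by linear_combination -h / 2
  exact (mul_eq_zero.mp h4).resolve_left h3

/-- For `p = 1` the Laurent expansion is the same on every strip between zeros of the
denominator. -/
theorem exists_hasSum_thetaRatio_strips {P : ℕ} (hP : 1 ≤ P) (r : ℤ) {τ : ℂ} (hτ : 0 < τ.im) :
    ∃ c : ℤ → ℂ, (∀ n, c (-n) = c n) ∧ ∀ k : ℕ, ∀ u : ℂ, k * τ.im < u.im →
      u.im < (k + 1) * τ.im →
        HasSum (fun n : ℤ => c n * halfVar u ^ n) (thetaRatio 1 P r u τ) := by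
  choose c hce hc using fun r => exists_even_hasSum_thetaRatio (p := 1) (p' := P) le_rfl hP r hτ
  refine ⟨c r, hce r, ?_⟩
  -- Evenness of both the function and its coefficients carries the expansion across the real axis
  -- by u ↦ -u.
  have hneg : ∀ r : ℤ, ∀ u : ℂ, -τ.im < u.im → u.im < 0 →
      HasSum (fun n : ℤ => c r n * halfVar u ^ n) (thetaRatio 1 P r u τ) := by
    intro r u hu hu'
    have h := hc r (-u) (by rw [Complex.neg_im]; linarith) (by rw [Complex.neg_im]; linarith)
    rw [halfVar_neg, thetaRatio_neg le_rfl hP r hτ] at h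
    refine (hasSum_congr_fun fun n => ?_).mpr (hasSum_laurent_inv h)
    rw [hce]
  set M := epow τ (-(P / 4)) / epow τ (-((2 : ℕ) / 4))
  -- Translation by τ takes the strip below the real axis to the fundamental one. As the same
  -- coefficients serve on both, the functional equation becomes a relation between coefficients,
  -- which then propagates the expansion upwards strip by strip. The label alternates between r and
  -- P - r, hence the induction over all r.
  have hflow : ∀ r : ℤ, ∀ n, c r n * halfVar τ ^ n = M * c (P - r) (n - (P - 2 : ℤ)) := by
    intro r
    refine congrFun (laurent_unique (a := -τ.im) (b := 0) (by linarith)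
      (fun u => thetaRatio 1 P r (u + τ) τ) (fun u hu hu' => hasSum_laurent_mul ?_)
      fun u hu hu' => ?_)
    · rw [← halfVar_add]
      exact hc r _ (by rw [Complex.add_im]; linarith) (by rw [Complex.add_im]; linarith)
    · rw [thetaRatio_add_tau hP r hτ]
      refine (hasSum_congr_fun fun n => ?_).mpr ((hasSum_laurent_shift (halfVar_ne_zero u)
        (hneg (P - r) u hu hu') (P - 2)).mul_left M)
      ring
  intro k
  induction k generalizing r with
  | zero => intro u hu hu'; exact hc r u (by simpa using hu) (by simpa using hu')
  | succ k ih =>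
    intro u hu hu'
    push_cast at hu hu'
    obtain ⟨v, rfl⟩ : ∃ v, u = v + τ := ⟨u - τ, by ring⟩
    rw [Complex.add_im] at hu hu'
    have h := (hasSum_laurent_shift (halfVar_ne_zero v)
      (ih (P - r) v (by linarith) (by linarith)) (P - 2)).mul_left M
    rw [thetaRatio_add_tau hP r hτ]
    refine (hasSum_congr_fun fun n => ?_).mpr h
    rw [halfVar_add, mul_zpow]
    linear_combination halfVar v ^ n * hflow r n

/-! ### The product of two numerators over the denominator -/

/-- The product of two characters, multiplied by the Weyl denominator. -/
noncomputable def thetaProduct (p₁ p₁' p₂ p₂' : ℕ) (r s : ℤ) (u τ : ℂ) : ℂ :=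
  thetaNumerator p₁ p₁' r u τ * thetaNumerator p₂ p₂' s u τ / thetaNumerator 1 2 1 u τ

theorem thetaProduct_comm (p₁ p₁' p₂ p₂' : ℕ) (r s : ℤ) (u τ : ℂ) :
    thetaProduct p₁ p₁' p₂ p₂' r s u τ = thetaProduct p₂ p₂' p₁ p₁' s r u τ := by
  rw [thetaProduct, thetaProduct, mul_comm (thetaNumerator p₁ p₁' r u τ)]

theorem exists_hasSum_thetaProduct_aux {p₁' p₂ p₂' : ℕ} (hp₁' : 1 ≤ p₁')
    (hp₂ : 1 ≤ p₂) (hp₂' : 1 ≤ p₂') (r s : ℤ) {τ : ℂ} (hτ : 0 < τ.im) :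
    ∃ f : ℤ → ℂ, (∀ n, f (-n) = -f n) ∧ ∀ k : ℕ, ∀ u : ℂ, k * τ.im < u.im →
      u.im < (k + 1) * τ.im →
        HasSum (fun n : ℤ => f n * halfVar u ^ n) (thetaProduct 1 p₁' p₂ p₂' r s u τ) := by
  obtain ⟨c, hce, hc⟩ := exists_hasSum_thetaRatio_strips hp₁' r hτ
  refine ⟨laurentMul c (thetaCoeff p₂ p₂' s τ), laurentMul_odd hce (thetaCoeff_neg _ _ _ _),
    fun k u hu hu' => ?_⟩
  convert (HasSum.laurentMul (halfVar_ne_zero u) (hc k u hu hu')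
    (hasSum_thetaNumerator hp₂ hp₂' s hτ u)).2 using 1
  rw [thetaProduct, thetaRatio]; ring

theorem exists_hasSum_thetaProduct {p₁ p₁' p₂ p₂' : ℕ} (hp₁ : 1 ≤ p₁) (hp₁' : 1 ≤ p₁')
    (hp₂ : 1 ≤ p₂) (hp₂' : 1 ≤ p₂') (hone : p₁ = 1 ∨ p₂ = 1) (r s : ℤ) {τ : ℂ} (hτ : 0 < τ.im) :
    ∃ f : ℤ → ℂ, (∀ n, f (-n) = -f n) ∧ ∀ k : ℕ, ∀ u : ℂ, k * τ.im < u.im →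
      u.im < (k + 1) * τ.im →
        HasSum (fun n : ℤ => f n * halfVar u ^ n) (thetaProduct p₁ p₁' p₂ p₂' r s u τ) := by
  rcases hone with rfl | rfl
  · exact exists_hasSum_thetaProduct_aux hp₁' hp₂ hp₂' r s hτ
  · simp only [thetaProduct_comm p₁]
    exact exists_hasSum_thetaProduct_aux hp₂' hp₁ hp₁' s r hτ

theorem thetaProduct_add_one {p₁ p₁' p₂ p₂' : ℕ} (hp₁ : 1 ≤ p₁) (hp₁' : 1 ≤ p₁')
    (hp₂ : 1 ≤ p₂) (hp₂' : 1 ≤ p₂') (r s : ℤ) {τ : ℂ} (hτ : 0 < τ.im) (u : ℂ) :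
    thetaProduct p₁ p₁' p₂ p₂' r s (u + 1) τ =
      (-1) ^ (r + s - 1) * thetaProduct p₁ p₁' p₂ p₂' r s u τ := by
  rw [thetaProduct, thetaNumerator_add_one hp₁ hp₁' r hτ, thetaNumerator_add_one hp₂ hp₂' s hτ,
    thetaNumerator_add_one le_rfl one_le_two 1 hτ, zpow_sub₀ (by norm_num),
    zpow_add₀ (by norm_num), thetaProduct]
  simp only [div_eq_mul_inv, mul_inv]
  ring

theorem sumNumerator_cast {p₁ p₁' p₂ p₂' : ℕ} (hp₁' : p₁ < p₁') (hp₂' : p₂ < p₂') :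
    (sumNumerator p₁ p₁' p₂ p₂' : ℤ) = p₁' * p₂ + p₂' * p₁ - 2 * p₁ * p₂ := by
  have h1 : p₁ * p₂ ≤ p₁' * p₂ := by gcongr
  have h2 : p₂ * p₁ ≤ p₂' * p₁ := by gcongr
  rw [sumNumerator, Nat.cast_sub (by nlinarith)]
  push_cast; ring

/-- The translation by 2p₁p₂τ is p₂ periods of the first numerator, p₁ of the second and p₁p₂ of the
denominator; the three multipliers combine into that of a theta function of degree p₃'. -/
theorem thetaProduct_add_period {p₁ p₁' p₂ p₂' : ℕ} (hp₁ : 1 ≤ p₁) (hp₁' : p₁ < p₁')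
    (hp₂ : 1 ≤ p₂) (hp₂' : p₂ < p₂') (r s : ℤ) {τ : ℂ} (hτ : 0 < τ.im) (u : ℂ) :
    thetaProduct p₁ p₁' p₂ p₂' r s (u + 2 * (p₁ * p₂ : ℕ) * τ) τ =
      epow τ (-((p₁ * p₂ : ℕ) * sumNumerator p₁ p₁' p₂ p₂')) *
        (halfVar u ^ (2 * sumNumerator p₁ p₁' p₂ p₂' : ℤ) *
          thetaProduct p₁ p₁' p₂ p₂' r s u τ) := by
  have hM := sumNumerator_cast hp₁' hp₂'
  have hMQ : (sumNumerator p₁ p₁' p₂ p₂' : ℚ) = p₁' * p₂ + p₂' * p₁ - 2 * p₁ * p₂ := by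
    exact_mod_cast congrArg (Int.cast : ℤ → ℚ) hM
  have h1 := thetaNumerator_add_period hp₁ (hp₁.trans hp₁'.le) r hτ p₂ u
  have h2 := thetaNumerator_add_period hp₂ (hp₂.trans hp₂'.le) s hτ p₁ u
  have h3 := thetaNumerator_add_period le_rfl one_le_two 1 hτ (p₁ * p₂) u
  rw [show (u + 2 * p₁ * p₂ * τ : ℂ) = u + 2 * (p₁ * p₂ : ℕ) * τ by push_cast; ring] at h1
  rw [show (u + 2 * p₂ * p₁ * τ : ℂ) = u + 2 * (p₁ * p₂ : ℕ) * τ by push_cast; ring] at h2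
  rw [show (u + 2 * (1 : ℕ) * (p₁ * p₂ : ℕ) * τ : ℂ) = u + 2 * (p₁ * p₂ : ℕ) * τ by
    push_cast; ring] at h3
  rw [thetaProduct, h1, h2, h3, thetaProduct, hM, hMQ,
    show (-(((p₁ * p₂ : ℕ) : ℚ) * (p₁' * p₂ + p₂' * p₁ - 2 * p₁ * p₂))) =
      -(p₁ * p₁' * p₂ ^ 2) + -(p₂ * p₂' * p₁ ^ 2) - -((1 : ℕ) * (2 : ℕ) * (p₁ * p₂ : ℕ) ^ 2) by
        push_cast; ring,
    show (2 * (p₁' * p₂ + p₂' * p₁ - 2 * p₁ * p₂) : ℤ) =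
      2 * p₁' * p₂ + 2 * p₂' * p₁ - 2 * (2 : ℕ) * (p₁ * p₂ : ℕ) by push_cast; ring,
    epow_sub, epow_add, zpow_sub₀ (halfVar_ne_zero u), zpow_add₀ (halfVar_ne_zero u)]
  simp only [div_eq_mul_inv, mul_inv]
  ring

/-! ### Odd quasi-periodic coefficients as combinations of theta coefficients -/

/-- The values at 0 and M vanish because both points are fixed by negation modulo 2M; reflection
then covers the other half of a period. -/
theorem eq_zero_of_odd_of_periodic {e : ℤ → ℂ} {M : ℤ} (hM : 0 < M) (hodd : ∀ n, e (-n) = -e n)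
    (hper : ∀ n, e (n - 2 * M) = e n) (h : ∀ n, 0 < n → n < M → e n = 0) (n : ℤ) : e n = 0 := by
  have hp : Function.Periodic e (2 * M) := fun n => by
    rw [← hper (n + 2 * M), add_sub_cancel_right]
  have h0 : e 0 = 0 := self_eq_neg.mp (by simpa using hodd 0)
  have hMz : e M = 0 := self_eq_neg.mp (by
    rw [← hodd, ← hper M]; congr 1; ring)
  have key : ∀ n, 0 ≤ n → n ≤ M → e n = 0 := by
    intro n hn hn'
    rcases hn.eq_or_lt with rfl | hn
    · exact h0
    rcases hn'.eq_or_lt with rfl | hn'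
    · exact hMz
    exact h n hn hn'
  have hmod : e (n % (2 * M)) = e n := by
    have := hp.sub_zsmul_eq (x := n) (n / (2 * M))
    rw [← this, Int.emod_def]
    congr 1; simp [mul_comm]
  rw [← hmod]
  have hlo := Int.emod_nonneg n (show 2 * M ≠ 0 by positivity)
  have hhi := Int.emod_lt_of_pos n (show 0 < 2 * M by positivity)
  by_cases hc : n % (2 * M) ≤ M
  · exact key _ hlo hc
  · rw [← hper, ← neg_eq_zero, ← hodd]
    exact key _ (by linarith) (by linarith)

theorem thetaCoeff_apply {p M : ℕ} {s n : ℤ} (hs : 0 < s) (hs' : s < M) (hn : 0 < n) (hn' : n < M)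
    (τ : ℂ) : thetaCoeff p M s τ n = if s = n then epow τ (p * n ^ 2 / (4 * M)) else 0 := by
  have h1 : ((2 * M : ℤ) ∣ n - s) ↔ s = n := by
    refine ⟨fun h => ?_, fun h => by simp [h]⟩
    have := Int.eq_zero_of_abs_lt_dvd h (by rw [abs_lt]; constructor <;> linarith)
    linarith
  have h2 : ¬ (2 * M : ℤ) ∣ n + s := by
    intro h
    have := Int.eq_zero_of_abs_lt_dvd h (by rw [abs_lt]; constructor <;> linarith)
    linarith
  simp [thetaCoeff, thetaCoeffHalf, h1, h2]

theorem thetaCoeff_mul_epow_periodic (p M : ℕ) (s : ℤ) (τ : ℂ) (n : ℤ) :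
    thetaCoeff p M s τ (n - 2 * M) * epow τ (-(p * (n - 2 * M : ℤ) ^ 2 / (4 * M))) =
      thetaCoeff p M s τ n * epow τ (-(p * n ^ 2 / (4 * M))) := by
  have e : ∀ s : ℤ, ((2 * M : ℤ) ∣ n - 2 * M - s) ↔ ((2 * M : ℤ) ∣ n - s) := by
    intro s
    rw [show n - 2 * M - s = n - s - 2 * M by ring]
    exact dvd_sub_left (dvd_refl _)
  simp only [thetaCoeff, thetaCoeffHalf, e, sub_mul, mul_assoc, ← epow_add, add_neg_cancel]

theorem two_le_sumNumerator {p₁ p₁' p₂ p₂' : ℕ} (hp₁ : 1 ≤ p₁) (hp₁' : p₁ < p₁')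
    (hp₂ : 1 ≤ p₂) (hp₂' : p₂ < p₂') : 2 ≤ sumNumerator p₁ p₁' p₂ p₂' := by
  have h := sumNumerator_cast hp₁' hp₂'
  zify at *
  nlinarith [mul_le_mul_of_nonneg_right (Int.add_one_le_of_lt hp₁') (by linarith : (0 : ℤ) ≤ p₂),
    mul_le_mul_of_nonneg_right (Int.add_one_le_of_lt hp₂') (by linarith : (0 : ℤ) ≤ p₁)]

/-- The coefficient of the branching expansion in terms of the Laurent coefficients `f` of
`thetaProduct`. -/
noncomputable def branchingCoeff (p M k : ℕ) (τ : ℂ) (f : ℤ → ℂ) (ℓ : ℕ) : ℂ :=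
  if ℓ < M - 1 ∧ Even (k + ℓ) then f (ℓ + 1) * epow τ (-(p * (ℓ + 1) ^ 2 / (4 * M))) else 0

/-- An odd Laurent series with theta-like periodicity is a combination of theta numerators. -/
theorem eq_sum_branchingCoeff {p M k : ℕ} (hM : 2 ≤ M) {τ : ℂ} {f : ℤ → ℂ}
    (hodd : ∀ n, f (-n) = -f n) (hpar : ∀ n : ℤ, ¬ Even (n - (k + 1)) → f n = 0)
    (hper : ∀ n, f (n - 2 * M) * epow τ (-(p * (n - 2 * M : ℤ) ^ 2 / (4 * M))) =
      f n * epow τ (-(p * n ^ 2 / (4 * M)))) (n : ℤ) :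
    f n = ∑ ℓ ∈ (Finset.range (M - 1)).filter (fun ℓ => Even (k + ℓ)),
      branchingCoeff p M k τ f ℓ * thetaCoeff p M (ℓ + 1) τ n := by
  set S : ℤ → ℂ := fun n => ∑ ℓ ∈ (Finset.range (M - 1)).filter (fun ℓ => Even (k + ℓ)),
      branchingCoeff p M k τ f ℓ * thetaCoeff p M (ℓ + 1) τ n with hS
  -- Multiplying by q^(-pn²/4M) makes the quasi-periodicity exact. The coefficients were chosen so
  -- that the difference vanishes for 0 < n < M.
  have h := eq_zero_of_odd_of_periodic
    (e := fun n => (f n - S n) * epow τ (-(p * n ^ 2 / (4 * M)))) (M := M) (by positivity)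
    (fun n => ?_) (fun n => ?_) (fun n hn hn' => ?_) n
  · exact sub_eq_zero.mp ((mul_eq_zero.mp h).resolve_right (epow_ne_zero _ _))
  · simp only [hS, hodd, thetaCoeff_neg, mul_neg, Finset.sum_neg_distrib, Int.cast_neg, neg_sq]
    ring
  · have : S (n - 2 * M) * epow τ (-(p * (n - 2 * M : ℤ) ^ 2 / (4 * M))) =
        S n * epow τ (-(p * n ^ 2 / (4 * M))) := by
      simp only [hS, Finset.sum_mul, mul_assoc, thetaCoeff_mul_epow_periodic]
    simp only [sub_mul, this, hper]
  · obtain ⟨m, rfl⟩ : ∃ m : ℕ, n = m + 1 := ⟨(n - 1).toNat, by lia⟩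
    have hm : m < M - 1 := by lia
    have hSn : S (m + 1) = f (m + 1) := by
      simp only [hS]
      by_cases he : Even (k + m)
      · rw [Finset.sum_eq_single m]
        · rw [thetaCoeff_apply (by lia) (by lia) (by lia) (by lia), if_pos rfl, branchingCoeff,
            if_pos ⟨hm, he⟩, mul_assoc, ← epow_add]
          push_cast
          rw [neg_add_cancel, epow_zero, mul_one]
        · intro ℓ hℓ hne
          rw [Finset.mem_filter, Finset.mem_range] at hℓ
          rw [thetaCoeff_apply (by lia) (by lia) (by lia) (by lia), if_neg (by lia), mul_zero]
        · intro hnot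
          exact absurd (Finset.mem_filter.mpr ⟨Finset.mem_range.mpr hm, he⟩) hnot
      · rw [hpar (m + 1) (fun h => he (by
          have h2 : ((k : ℤ) + m) = (m + 1 - (k + 1)) + 2 * k := by ring
          have : Even ((k : ℤ) + m) := by rw [h2]; exact h.add (even_two_mul _)
          exact_mod_cast this))]
        refine Finset.sum_eq_zero fun ℓ hℓ => ?_
        rw [Finset.mem_filter, Finset.mem_range] at hℓ
        rw [thetaCoeff_apply (by lia) (by lia) (by lia) (by lia), if_neg, mul_zero]
        intro h
        exact he (by rw [show m = ℓ by lia]; exact hℓ.2)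
    simp only [hSn, sub_self, zero_mul]

/-! ### Existence and uniqueness of branching and string expansions -/

theorem sum_branching_thetaCoeff {p M k : ℕ} {B : ℕ → ℂ} {ℓ : ℕ} (hℓ : ℓ < M - 1)
    (hk : Even (k + ℓ)) (τ : ℂ) :
    ∑ i ∈ (Finset.range (M - 1)).filter (fun i => Even (k + i)),
      B i * thetaCoeff p M (i + 1) τ (ℓ + 1) = B ℓ * epow τ (p * (ℓ + 1) ^ 2 / (4 * M)) := by
  rw [Finset.sum_eq_single ℓ]
  · rw [thetaCoeff_apply (by lia) (by lia) (by lia) (by lia), if_pos rfl]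
    push_cast; rfl
  · intro i hi hne
    rw [Finset.mem_filter, Finset.mem_range] at hi
    rw [thetaCoeff_apply (by lia) (by lia) (by lia) (by lia), if_neg (by lia), mul_zero]
  · intro hnot
    exact absurd (Finset.mem_filter.mpr ⟨Finset.mem_range.mpr hℓ, hk⟩) hnot

theorem branching_identity_iff {p₁ p₁' p₂ p₂' ℓ₁ ℓ₂ : ℕ} {u τ : ℂ} (hu : 0 < u.im)
    (hu' : u.im < τ.im) (B : ℕ → ℂ) (s : Finset ℕ) :
    (affineCharacter p₁ p₁' ℓ₁ u τ * affineCharacter p₂ p₂' ℓ₂ u τ =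
      ∑ ℓ₃ ∈ s, B ℓ₃ * affineCharacter (p₁ * p₂) (sumNumerator p₁ p₁' p₂ p₂') ℓ₃ u τ) ↔
    thetaProduct p₁ p₁' p₂ p₂' (ℓ₁ + 1) (ℓ₂ + 1) u τ =
      ∑ ℓ₃ ∈ s, B ℓ₃ * thetaNumerator (p₁ * p₂) (sumNumerator p₁ p₁' p₂ p₂') (ℓ₃ + 1) u τ := by
  have hD := weylDenominator_ne_zero hu hu'
  simp only [affineCharacter_eq, thetaRatio, thetaProduct, mul_div_assoc', ← Finset.sum_div]
  rw [div_left_inj' hD, div_mul_eq_mul_div]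

/-- For 0 < n < p₃' the only theta numerator that contributes to the n-th coefficient is the one
labelled n, so B is read off from f; conversely, oddness, parity and quasi-periodicity of f ensure
that this choice reproduces the product. -/
theorem isBranchingExpansion_iff {p₁ p₁' p₂ p₂' ℓ₁ ℓ₂ : ℕ} (hp₁ : 1 ≤ p₁) (hp₁' : p₁ < p₁')
    (hp₂ : 1 ≤ p₂) (hp₂' : p₂ < p₂') (hone : p₁ = 1 ∨ p₂ = 1) {τ : ℂ} (hτ : 0 < τ.im)
    {f : ℤ → ℂ} (hf : ∀ u : ℂ, 0 < u.im → u.im < τ.im →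
      HasSum (fun n : ℤ => f n * halfVar u ^ n)
        (thetaProduct p₁ p₁' p₂ p₂' (ℓ₁ + 1) (ℓ₂ + 1) u τ)) (B : ℕ → ℂ) :
    IsBranchingExpansion p₁ p₁' p₂ p₂' ℓ₁ ℓ₂ τ B ↔
      B = branchingCoeff (p₁ * p₂) (sumNumerator p₁ p₁' p₂ p₂') (ℓ₁ + ℓ₂) τ f := by
  have hM := two_le_sumNumerator hp₁ hp₁' hp₂ hp₂'
  have hp : 1 ≤ p₁ * p₂ := Nat.mul_pos hp₁ hp₂
  set M := sumNumerator p₁ p₁' p₂ p₂' with hMdef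
  have hsum : ∀ (B : ℕ → ℂ) (u : ℂ), HasSum (fun n : ℤ =>
      (∑ ℓ ∈ (Finset.range (M - 1)).filter (fun ℓ => Even (ℓ₁ + ℓ₂ + ℓ)),
        B ℓ * thetaCoeff (p₁ * p₂) M (ℓ + 1) τ n) * halfVar u ^ n)
      (∑ ℓ ∈ (Finset.range (M - 1)).filter (fun ℓ => Even (ℓ₁ + ℓ₂ + ℓ)),
        B ℓ * thetaNumerator (p₁ * p₂) M (ℓ + 1) u τ) := by
    intro B u
    simp only [Finset.sum_mul, mul_assoc]
    exact hasSum_sum fun ℓ _ =>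
      (hasSum_thetaNumerator hp (one_le_two.trans hM) (ℓ + 1) hτ u).mul_left (B ℓ)
  constructor
  · rintro ⟨h0, hB⟩
    have hfS := laurent_unique hτ _ hf fun u hu hu' => by
      rw [(branching_identity_iff hu hu' B _).mp (hB u hu hu')]
      exact hsum B u
    funext ℓ
    rw [branchingCoeff]
    split_ifs with h
    · rw [congrFun hfS (ℓ + 1), sum_branching_thetaCoeff h.1 h.2, mul_assoc, ← epow_add,
        add_neg_cancel, epow_zero, mul_one]
    · exact h0 ℓ h
  · rintro rfl
    refine ⟨fun ℓ h => if_neg h, fun u hu hu' => ?_⟩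
    rw [branching_identity_iff hu hu', ← hMdef]
    refine (hf u hu hu').unique ?_
    obtain ⟨f', hodd, hf'⟩ := exists_hasSum_thetaProduct hp₁ (hp₁.trans hp₁'.le) hp₂
      (hp₂.trans hp₂'.le) hone (ℓ₁ + 1) (ℓ₂ + 1) hτ
    obtain rfl : f' = f := laurent_unique hτ _
      (fun u hu hu' => hf' 0 u (by simpa using hu) (by simpa using hu')) hf
    refine (hasSum_congr_fun fun n => ?_).mp (hsum _ u)
    rw [← eq_sum_branchingCoeff hM hodd]
    · intro n hn
      refine laurent_eq_zero_of_odd hτ hf (fun u => thetaProduct_add_one hp₁ (hp₁.trans hp₁'.le)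
        hp₂ (hp₂.trans hp₂'.le) (ℓ₁ + 1) (ℓ₂ + 1) hτ u) ?_
      push_cast at hn
      convert hn using 3
      ring
    · intro n
      -- The translated function is expanded twice: directly, on the strip numbered 2p₁p₂, and
      -- through the multiplier, on the fundamental strip. Using the same f' on both is what
      -- requires one of p₁, p₂ to be 1.
      have hp2 := congrFun (laurent_unique (c := fun n => f' n * halfVar (2 * (p₁ * p₂ : ℕ) * τ) ^ n)
        (d := fun n => epow τ (-((p₁ * p₂ : ℕ) * M)) * f' (n - 2 * M)) hτ
        (fun u => thetaProduct p₁ p₁' p₂ p₂' (ℓ₁ + 1) (ℓ₂ + 1) (u + 2 * (p₁ * p₂ : ℕ) * τ) τ)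
        (fun u hu hu' => hasSum_laurent_mul (by
          have him : (u + 2 * (p₁ * p₂ : ℕ) * τ).im = u.im + (2 * (p₁ * p₂) : ℕ) * τ.im := by
            rw [show (u + 2 * (p₁ * p₂ : ℕ) * τ) = u + ((2 * (p₁ * p₂) : ℕ) : ℝ) * τ by
              push_cast; ring, Complex.add_im, Complex.im_ofReal_mul]
          rw [← halfVar_add]
          exact hf' (2 * (p₁ * p₂)) _ (by rw [him]; linarith) (by rw [him]; linarith)))
        (fun u hu hu' => by
          rw [thetaProduct_add_period hp₁ hp₁' hp₂ hp₂' _ _ hτ]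
          refine (hasSum_congr_fun fun n => ?_).mpr
            ((hasSum_laurent_shift (halfVar_ne_zero u) (hf u hu hu') (2 * M)).mul_left _)
          ring)) n
      have hM0 : (M : ℚ) ≠ 0 := by positivity
      rw [halfVar_zpow, show (2 * (p₁ * p₂ : ℕ) * τ : ℂ) = ((2 * (p₁ * p₂) : ℕ) : ℂ) * τ by
        push_cast; ring, epow_nat_mul] at hp2
      rw [show (-(((p₁ * p₂ : ℕ) : ℚ) * (n - 2 * M : ℤ) ^ 2 / (4 * M))) =
          -((p₁ * p₂ : ℕ) * M) + ((p₁ * p₂ : ℕ) * n - (p₁ * p₂ : ℕ) * n ^ 2 / (4 * M)) by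
            push_cast; field_simp; ring, epow_add, mul_left_comm, ← mul_assoc, ← hp2, mul_assoc,
          ← epow_add]
      congr 2
      push_cast; ring

theorem isBranchingExpansion_comm (p₁ p₁' p₂ p₂' ℓ₁ ℓ₂ : ℕ) (τ : ℂ) :
    IsBranchingExpansion p₁ p₁' p₂ p₂' ℓ₁ ℓ₂ τ = IsBranchingExpansion p₂ p₂' p₁ p₁' ℓ₂ ℓ₁ τ := by
  funext B
  have h : sumNumerator p₁ p₁' p₂ p₂' = sumNumerator p₂ p₂' p₁ p₁' := by
    rw [sumNumerator, sumNumerator, add_comm, mul_assoc, mul_assoc, mul_comm p₁ p₂]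
  simp only [IsBranchingExpansion, h, mul_comm p₁ p₂, add_comm ℓ₁ ℓ₂,
    mul_comm (affineCharacter p₁ p₁' ℓ₁ _ τ)]

theorem isStringExpansion_iff {p p' ℓ : ℕ} (hp : 1 ≤ p) (hp' : 1 ≤ p') {τ : ℂ} (hτ : 0 < τ.im)
    {c : ℤ → ℂ} (hc : ∀ u : ℂ, 0 < u.im → u.im < τ.im →
      HasSum (fun n : ℤ => c n * halfVar u ^ n) (thetaRatio p p' (ℓ + 1) u τ)) (C : ℤ → ℂ) :
    IsStringExpansion p p' ℓ τ C ↔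
      C = fun m => c m * epow τ (-((m : ℚ) ^ 2 / (4 * affineLevel p p'))) := by
  have hi : Function.Injective fun k : ℤ => 2 * k + (ℓ : ℤ) := fun a b h => by simpa using h
  have hrange : ∀ n : ℤ, n ∉ Set.range (fun k : ℤ => 2 * k + (ℓ : ℤ)) ↔ ¬ Even (n + ℓ) := by
    intro n
    rw [not_iff_not]
    constructor
    · rintro ⟨k, rfl⟩
      exact ⟨k + ℓ, by ring⟩
    · rintro ⟨k, hk⟩
      exact ⟨k - ℓ, by simp only; linarith⟩
  have hsum : ∀ (C : ℤ → ℂ) (u x : ℂ), (∀ m : ℤ, ¬ Even (m + (ℓ : ℤ)) → C m = 0) →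
      (HasSum (fun k : ℤ => C (2 * k + (ℓ : ℤ)) *
          epow τ (((2 * k + (ℓ : ℤ) : ℤ) : ℚ) ^ 2 / (4 * affineLevel p p')) *
          epow u (-((2 * k + (ℓ : ℤ) : ℤ) : ℚ) / 2)) x ↔
        HasSum (fun n : ℤ => (C n * epow τ ((n : ℚ) ^ 2 / (4 * affineLevel p p'))) *
          halfVar u ^ n) x) := by
    intro C u x h0
    rw [← hi.hasSum_iff (f := fun n : ℤ => (C n * epow τ ((n : ℚ) ^ 2 / (4 * affineLevel p p'))) *
      halfVar u ^ n) (fun n hn => by simp only [h0 n ((hrange n).mp hn), zero_mul])]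
    refine hasSum_congr_fun fun k => ?_
    simp only [Function.comp, halfVar_zpow]
  constructor
  · rintro ⟨h0, h⟩
    have := laurent_unique hτ _ (fun u hu hu' => (hsum C u _ h0).mp (h u hu hu'))
      (fun u hu hu' => by rw [affineCharacter_eq]; exact hc u hu hu')
    funext m
    rw [← this, mul_assoc, ← epow_add, add_neg_cancel, epow_zero, mul_one]
  · rintro rfl
    have h0 : ∀ m : ℤ, ¬ Even (m + (ℓ : ℤ)) →
        c m * epow τ (-((m : ℚ) ^ 2 / (4 * affineLevel p p'))) = 0 := by
      intro m hm
      rw [laurent_eq_zero_of_odd hτ hc (fun u => thetaRatio_add_one hp hp' (ℓ + 1) hτ u), zero_mul]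
      rw [add_sub_cancel_right]
      rwa [Int.even_sub, ← Int.even_add]
    refine ⟨h0, fun u hu hu' => (hsum _ u _ h0).mpr ?_⟩
    rw [affineCharacter_eq]
    refine (hasSum_congr_fun fun n => ?_).mpr (hc u hu hu')
    rw [mul_assoc (c n), ← epow_add, neg_add_cancel, epow_zero, mul_one]

/-! ### The convolution formula and the exponents of q -/

theorem thetaCoeffHalf_apply (p P : ℕ) (r j : ℤ) (τ : ℂ) :
    thetaCoeffHalf p P r τ (2 * P * j + r) =
      epow τ (p * (2 * P * j + r) ^ 2 / (4 * P)) := by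
  simp [thetaCoeffHalf]

/-- The coefficients of a theta function times an even Laurent series. -/
theorem hasSum_laurentMul_thetaCoeff {p P : ℕ} (hp : 1 ≤ p) (hP : 1 ≤ P) (r s : ℤ) {u τ f : ℂ}
    (hτ : 0 < τ.im) {c : ℤ → ℂ} (hce : ∀ n, c (-n) = c n)
    (hc : HasSum (fun n : ℤ => c n * halfVar u ^ n) f) :
    HasSum (fun j : ℤ => epow τ (p * (2 * P * j + r) ^ 2 / (4 * P)) *
      (c (2 * P * j + r - s) - c (2 * P * j + r + s))) (laurentMul (thetaCoeff p P r τ) c s) := by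
  have h1 := (HasSum.laurentMul (halfVar_ne_zero u) (hasSum_classicalTheta hp hP r hτ u) hc).1 s
  have h2 := (HasSum.laurentMul (halfVar_ne_zero u) (hasSum_classicalTheta hp hP (-r) hτ u) hc).1 s
  -- Reflecting the summation for the -r half puts both halves on the progression 2Pj + r.
  have h2' := (Equiv.neg ℤ).hasSum_iff.mpr h2.hasSum
  have hi : Function.Injective fun j : ℤ => 2 * (P : ℤ) * j + r := by
    intro a b h
    have : (2 * (P : ℤ)) ≠ 0 := by positivity
    simpa [this] using h
  have hz : ∀ n : ℤ, n ∉ Set.range (fun j : ℤ => 2 * (P : ℤ) * j + r) →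
      thetaCoeffHalf p P r τ n = 0 := by
    intro n hn
    have : ¬ (2 * P : ℤ) ∣ n - r := by
      rintro ⟨k, hk⟩
      exact hn ⟨k, by simp only; linarith⟩
    simp [thetaCoeffHalf, this]
  have e1 := (hi.hasSum_iff (fun n hn => by rw [hz n hn, zero_mul])).mpr h1.hasSum
  have e2 := (hi.hasSum_iff (fun n hn => by
    simp only [Function.comp, Equiv.neg_apply]
    rw [thetaCoeffHalf_neg, neg_neg, hz n hn, zero_mul])).mpr h2'
  have hv : laurentMul (thetaCoeff p P r τ) c s =
      (∑' k, thetaCoeffHalf p P r τ k * c (s - k)) -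
        ∑' k, thetaCoeffHalf p P (-r) τ k * c (s - k) := by
    rw [laurentMul, ← h1.tsum_sub h2]
    simp only [thetaCoeff, sub_mul]
  rw [hv]
  refine (hasSum_congr_fun fun j => ?_).mpr (e1.sub e2)
  simp only [Function.comp, Equiv.neg_apply]
  rw [thetaCoeffHalf_neg, neg_neg, thetaCoeffHalf_apply, ← hce (2 * P * j + r - s), mul_sub]
  congr 3 <;> ring

/-- The right-hand side is the exponent from the convolution. It equals the one in
`branching_exponent_add`, which is why a single theta weight multiplies both string functions. -/
theorem branching_exponent_sub {N P P' p r s j : ℚ} (hN : N ≠ 0) (hP : P ≠ 0) (hP' : P' ≠ 0)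
    (h : P' = P + N * p) :
    (P' * r - P * s) ^ 2 / (4 * N * P * P') + j * (P * P' * j + P' * r - P * s) / N +
      -((2 * P * j + r - s) ^ 2 / (4 * N)) =
    -(p * s ^ 2 / (4 * P')) + p * (2 * P * j + r) ^ 2 / (4 * P) := by
  have hp : p = (P' - P) / N := by field_simp; linarith
  rw [hp]
  field_simp
  ring

theorem branching_exponent_add {N P P' p r s j : ℚ} (hN : N ≠ 0) (hP : P ≠ 0) (hP' : P' ≠ 0)
    (h : P' = P + N * p) :
    (P' * r - P * s) ^ 2 / (4 * N * P * P') + (P * j + r) * (P' * j + s) / N +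
      -((2 * P * j + r + s) ^ 2 / (4 * N)) =
    -(p * s ^ 2 / (4 * P')) + p * (2 * P * j + r) ^ 2 / (4 * P) := by
  have hp : p = (P' - P) / N := by field_simp; linarith
  rw [hp]
  field_simp
  ring

theorem sumNumerator_eq_mul {p₁ p₁' p₂ p₂' : ℕ} (hp₁' : p₁ < p₁') (hp₂ : 1 ≤ p₂)
    (hp₂' : p₂ < p₂') :
    (sumNumerator p₁ p₁' p₂ p₂' : ℚ) = p₂ * (p₁' + affineLevel p₂ p₂' * p₁) := by
  have h : (sumNumerator p₁ p₁' p₂ p₂' : ℚ) = p₁' * p₂ + p₂' * p₁ - 2 * p₁ * p₂ := by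
    exact_mod_cast congrArg (Int.cast : ℤ → ℚ) (sumNumerator_cast hp₁' hp₂')
  have : (p₂ : ℚ) ≠ 0 := by positivity
  rw [h, affineLevel]
  field_simp
  ring

theorem stringFunction_eq {p p' ℓ : ℕ} (hp : 1 ≤ p) (hp' : 1 ≤ p') {τ : ℂ} (hτ : 0 < τ.im)
    {c : ℤ → ℂ} (hc : ∀ u : ℂ, 0 < u.im → u.im < τ.im →
      HasSum (fun n : ℤ => c n * halfVar u ^ n) (thetaRatio p p' (ℓ + 1) u τ)) (m : ℤ) :
    stringFunction p p' m ℓ τ = c m * epow τ (-((m : ℚ) ^ 2 / (4 * affineLevel p p'))) := by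
  have h := isStringExpansion_iff hp hp' hτ hc
  exact congrFun ((h _).mp (Classical.epsilon_spec ⟨_, (h _).mpr rfl⟩)) m

theorem hasSum_branchingTerm {p₁ p₁' p₂ p₂' : ℕ} (hp₁ : 1 ≤ p₁) (hp₁' : p₁ < p₁') (hp₂ : 1 ≤ p₂)
    (hp₂' : p₂ < p₂') (hN : affineLevel p₂ p₂' ≠ 0) {P' : ℚ}
    (hP' : P' = p₁' + affineLevel p₂ p₂' * p₁) (r s ℓ : ℕ) {τ : ℂ} (hτ : 0 < τ.im)
    {f : ℤ → ℂ} (hf : ∀ u : ℂ, 0 < u.im → u.im < τ.im →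
      HasSum (fun n : ℤ => f n * halfVar u ^ n) (thetaProduct p₁ p₁' p₂ p₂' r (ℓ + 1) u τ)) :
    HasSum (fun j : ℤ =>
        epow τ ((P' * r - p₁' * s) ^ 2 / (4 * affineLevel p₂ p₂' * p₁' * P')) *
          branchingTerm p₂ p₂' p₁' P' r s ℓ τ j)
      (f s * epow τ (-((p₁ * p₂ : ℕ) * s ^ 2 / (4 * sumNumerator p₁ p₁' p₂ p₂')))) := by
  obtain ⟨c, hce, hc⟩ := exists_even_hasSum_thetaRatio hp₂ (hp₂.trans hp₂'.le) (ℓ + 1) hτ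
  have hp₁'1 : 1 ≤ p₁' := hp₁.trans hp₁'.le
  have hfc : f = laurentMul (thetaCoeff p₁ p₁' r τ) c := laurent_unique hτ _ hf fun u hu hu' => by
    convert (HasSum.laurentMul (halfVar_ne_zero u) (hasSum_thetaNumerator hp₁ hp₁'1 r hτ u)
      (hc u hu hu')).2 using 1
    rw [thetaProduct, thetaRatio, mul_div_assoc]
  -- The convolution does not involve u, so convergence at a single point of the strip is enough.
  have him : 0 < (τ / 2).im ∧ (τ / 2).im < τ.im := by
    have : (τ / 2).im = τ.im / 2 := by simp
    constructor <;> linarith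
  have h := (hasSum_laurentMul_thetaCoeff hp₁ hp₁'1 r s hτ hce (hc _ him.1 him.2)).mul_right
    (epow τ (-((p₁ * p₂ : ℕ) * s ^ 2 / (4 * sumNumerator p₁ p₁' p₂ p₂'))))
  rw [hfc]
  refine (hasSum_congr_fun fun j => ?_).mpr h
  have hp₂0 : (p₂ : ℚ) ≠ 0 := by positivity
  have hP0 : (p₁' : ℚ) ≠ 0 := by positivity
  have hM := sumNumerator_eq_mul hp₁' hp₂ hp₂'
  rw [← hP'] at hM
  have hM2 : (0 : ℚ) < sumNumerator p₁ p₁' p₂ p₂' := by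
    exact_mod_cast zero_lt_two.trans_le (two_le_sumNumerator hp₁ hp₁' hp₂ hp₂')
  have hP'0 : P' ≠ 0 := by
    rintro rfl
    simp [hM] at hM2
  have he : (((p₁ * p₂ : ℕ) : ℚ) * s ^ 2 / (4 * sumNumerator p₁ p₁' p₂ p₂')) =
      p₁ * s ^ 2 / (4 * P') := by
    rw [hM]; push_cast; field_simp
  rw [branchingTerm, stringFunction_eq hp₂ (hp₂.trans hp₂'.le) hτ hc,
    stringFunction_eq hp₂ (hp₂.trans hp₂'.le) hτ hc, he]
  push_cast
  have h1 := congrArg (epow τ) (branching_exponent_sub (r := r) (s := s) (j := j) hN hP0 hP'0 hP')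
  have h2 := congrArg (epow τ) (branching_exponent_add (r := r) (s := s) (j := j) hN hP0 hP'0 hP')
  simp only [epow_add] at h1 h2
  linear_combination c (2 * p₁' * j + r - s) * h1 - c (2 * p₁' * j + r + s) * h2

theorem branchingFunction_eq {p₁ p₁' p₂ p₂' ℓ₁ ℓ₂ : ℕ} (hp₁ : 1 ≤ p₁) (hp₁' : p₁ < p₁')
    (hp₂ : 1 ≤ p₂) (hp₂' : p₂ < p₂') (hone : p₁ = 1 ∨ p₂ = 1) {τ : ℂ} (hτ : 0 < τ.im)
    {f : ℤ → ℂ} (hf : ∀ u : ℂ, 0 < u.im → u.im < τ.im →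
      HasSum (fun n : ℤ => f n * halfVar u ^ n)
        (thetaProduct p₁ p₁' p₂ p₂' (ℓ₁ + 1) (ℓ₂ + 1) u τ)) (ℓ₃ : ℕ) :
    branchingFunction p₁ p₁' p₂ p₂' ℓ₁ ℓ₂ ℓ₃ τ =
      branchingCoeff (p₁ * p₂) (sumNumerator p₁ p₁' p₂ p₂') (ℓ₁ + ℓ₂) τ f ℓ₃ := by
  have h := isBranchingExpansion_iff hp₁ hp₁' hp₂ hp₂' hone hτ hf
  exact congrFun ((h _).mp (Classical.epsilon_spec ⟨_, (h _).mpr rfl⟩)) ℓ₃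

theorem mainTheorem5 (p₁ p₁' p₂ p₂' : ℕ)
    (hp₁ : 1 ≤ p₁) (hp₁' : p₁ < p₁') (hp₂ : 1 ≤ p₂) (hp₂' : p₂ < p₂')
    (hcop₁ : Nat.Coprime p₁ p₁') (hcop₂ : Nat.Coprime p₂ p₂')
    (hone : p₁ = 1 ∨ p₂ = 1)
    (N₂ : ℚ) (hN₂ : N₂ = affineLevel p₂ p₂') (hN₂0 : N₂ ≠ 0)
    (P : ℕ) (hP : P = p₁') (P' : ℚ) (hP' : P' = (p₁' : ℚ) + N₂ * (p₁ : ℚ))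
    (r s ℓ : ℕ) (hr : 1 ≤ r) (hr' : r < P)
    (hℓ : ℓ + 1 < p₂') (hs : 1 ≤ s) (hs' : (s : ℚ) < (p₂ : ℚ) * P')
    (hpar : Even (r + ℓ + s))
    (τ : ℂ) (hτ : 0 < τ.im) :
    (∃! C : ℤ → ℂ, IsStringExpansion p₂ p₂' ℓ τ C) ∧
    (∃! B : ℕ → ℂ, IsBranchingExpansion p₁ p₁' p₂ p₂' (r - 1) ℓ τ B) ∧
    (∃! B : ℕ → ℂ, IsBranchingExpansion p₂ p₂' p₁ p₁' ℓ (r - 1) τ B) ∧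
    branchingFunction p₁ p₁' p₂ p₂' (r - 1) ℓ (s - 1) τ =
      branchingFunction p₂ p₂' p₁ p₁' ℓ (r - 1) (s - 1) τ ∧
    Summable (fun j : ℤ => branchingTerm p₂ p₂' P P' r s ℓ τ j) ∧
    branchingFunction p₁ p₁' p₂ p₂' (r - 1) ℓ (s - 1) τ =
      epow τ ((P' * (r : ℚ) - (P : ℚ) * (s : ℚ)) ^ 2 / (4 * N₂ * (P : ℚ) * P')) *
        ∑' j : ℤ, branchingTerm p₂ p₂' P P' r s ℓ τ j := by
  subst hN₂ hP
  obtain ⟨r, rfl⟩ : ∃ k, r = k + 1 := ⟨r - 1, by lia⟩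
  obtain ⟨s, rfl⟩ : ∃ k, s = k + 1 := ⟨s - 1, by lia⟩
  simp only [Nat.add_sub_cancel]
  have hP1 : 1 ≤ P := hp₁.trans hp₁'.le
  have hp₂'1 : 1 ≤ p₂' := hp₂.trans hp₂'.le
  obtain ⟨c, -, hc⟩ := exists_even_hasSum_thetaRatio hp₂ hp₂'1 (ℓ + 1) hτ
  obtain ⟨f, -, hf'⟩ := exists_hasSum_thetaProduct hp₁ hP1 hp₂ hp₂'1 hone (r + 1) (ℓ + 1) hτ
  have hf : ∀ u : ℂ, 0 < u.im → u.im < τ.im → HasSum (fun n : ℤ => f n * halfVar u ^ n)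
      (thetaProduct p₁ P p₂ p₂' (r + 1) (ℓ + 1) u τ) :=
    fun u hu hu' => hf' 0 u (by simpa using hu) (by simpa using hu')
  have hB := isBranchingExpansion_iff hp₁ hp₁' hp₂ hp₂' hone hτ hf
  have hBu : ∃! B : ℕ → ℂ, IsBranchingExpansion p₁ P p₂ p₂' r ℓ τ B :=
    ⟨_, (hB _).mpr rfl, fun B h => (hB B).mp h⟩
  have hsum := hasSum_branchingTerm hp₁ hp₁' hp₂ hp₂' hN₂0 hP' (r + 1) (s + 1) ℓ hτ
    (f := f) (by exact_mod_cast hf)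
  refine ⟨⟨_, (isStringExpansion_iff hp₂ hp₂'1 hτ hc _).mpr rfl,
      fun C h => (isStringExpansion_iff hp₂ hp₂'1 hτ hc C).mp h⟩, hBu, ?_, ?_, ?_, ?_⟩
  · rwa [← isBranchingExpansion_comm]
  · rw [branchingFunction, branchingFunction, isBranchingExpansion_comm]
  · exact (summable_mul_left_iff (epow_ne_zero _ _)).mp hsum.summable
  · rw [← tsum_mul_left, hsum.tsum_eq, branchingFunction_eq hp₁ hp₁' hp₂ hp₂' hone hτ hf,
      branchingCoeff, if_pos]
    · push_cast; rfl
    · have h1 : (s + 1 : ℕ) < sumNumerator p₁ P p₂ p₂' := by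
        have := sumNumerator_eq_mul hp₁' hp₂ hp₂'
        rw [← hP'] at this
        rw [← this] at hs'
        exact_mod_cast hs'
      refine ⟨by lia, ?_⟩
      rw [show r + 1 + ℓ + (s + 1) = r + ℓ + s + 2 by ring, Nat.even_add] at hpar
      simpa using hpar
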